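/- Let $\mathbb F$ be a field with $|\mathbb F|>2$, and let $G=\mathrm{Sp}_4(\mathbb F)$ be the group of linear automorphisms of $\mathbb F^4$ that preserve the symplectic form $\mathsf s$ with hyperbolic basis $\mathcal H=\{e_1,f_1,e_2,f_2\}$, that is, $\mathsf s(e_i,e_j)=\mathsf s(f_i,f_j)=0$ and $\mathsf s(e_i,f_j)=\delta_{ij}$. Define the following subgroups of $G$: - for $i=1,2$, $S^\pi_i$ consists of the elements of $G$ that fix every vector of $\mathcal H\setminus\{e_i,f_i\}$ and stabilize the subspace $\langle e_i,f_i\rangle$; - $M^\pi_1$ consists of the elements of $G$ that fix every vector of $\mathcal H\setminus\{f_1,f_2\}$ and stabilize the subspace $\langle e_1,f_1,e_2,f_2\rangle$; - $S^\pi_{12}=\langle S^\pi_1,S^\pi_2\rangle$, $Q^\pi_{11}=\langle M^\pi_1,S^\pi_1\rangle$, $Q^\pi_{12}=\langle M^\pi_1,S^\pi_2\rangle$. These six groups form an amalgam whose maps are the inclusions $S^\pi_1,S^\pi_2\le S^\pi_{12}$, $M^\pi_1,S^\pi_1\le Q^\pi_{11}$ and $M^\pi_1,S^\pi_2\le Q^\pi_{12}$.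 The universal completion of an amalgam is the group generated by all elements of its groups, subject to the relations that hold inside each group and to the identification of each element with its images under the maps of the amalgam. Then $\mathrm{Sp}_4(\mathbb F)$ is the universal completion of the amalgam $\{S^\pi_1,S^\pi_2,M^\pi_1,S^\pi_{12},Q^\pi_{11},Q^\pi_{12}\}$: the homomorphism from its universal completion to $G$ that extends the inclusions of the six subgroups into $G$ is an isomorphism. Moreover $$S^\pi_{12}\cong \mathrm{Sp}_2(\mathbb F)\times \mathrm{Sp}_2(\mathbb F),\qquad Q^\pi_{11}\cong Q^\pi_{12}\cong V\rtimes \mathrm{Sp}_2(\mathbb F),$$ where $V=\mathbb F.\mathbb F^2$ is the group on the set $\mathbb F^2\times\mathbb F$ with multiplication $(x,b)(y,c)=(x+y,\;b+c+x_1y_2-x_2y_1)$, on which $g\in\mathrm{Sp}_2(\mathbb F)$ acts by $g\cdot(x,b)=(gx,b)$. If $\mathrm{char}\,\mathbb F=2$, then $V$ is isomorphic to the additive group $\mathbb F^3$. -/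

import Mathlib

open Matrix

universe u v w

/-! ### Amalgams of groups and their universal completions -/

/-- An amalgam of groups over a partially ordered set `B`: a group for every `β : B` and a
homomorphism `A_β → A_γ` for all `β < γ`, compatible with composition. -/
structure Amalgam (B : Type v) [PartialOrder B] where
  grp : B → Type w
  [inst : ∀ β, Group (grp β)]
  map : ∀ {β γ : B}, β < γ → grp β →* grp γ
  map_map : ∀ {β γ δ : B} (h : β < γ) (k : γ < δ) (a : grp β),
    map k (map h a) = map (h.trans k) a

attribute [instance] Amalgam.inst

namespace Amalgam

variable {B : Type v} [PartialOrder B] (A : Amalgam.{v, w} B)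

/-- The relations that define the universal completion: all products that hold inside one group
of the amalgam, and the identification of every `a ∈ A_β` with its image in `A_γ` for `β < γ`. -/
inductive Rel : FreeGroup (Σ β, A.grp β) → Prop
  | mul (β : B) (a b : A.grp β) :
      Rel (FreeGroup.of ⟨β, a⟩ * FreeGroup.of ⟨β, b⟩ * (FreeGroup.of ⟨β, a * b⟩)⁻¹)
  | glue {β γ : B} (h : β < γ) (a : A.grp β) :
      Rel (FreeGroup.of ⟨β, a⟩ * (FreeGroup.of ⟨γ, A.map h a⟩)⁻¹)

/-- The universal completion of an amalgam: the group generated by the elements of all groups of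
the amalgam, subject to the relations `Amalgam.Rel`. -/
abbrev Completion : Type (max v w) := PresentedGroup {x | A.Rel x}

/-- A compatible family of homomorphisms from the groups of the amalgam to a group `K` induces a
homomorphism from the universal completion to `K`. -/
def lift {K : Type u} [Group K] (ψ : ∀ β, A.grp β →* K)
    (hψ : ∀ {β γ : B} (h : β < γ) (a : A.grp β), ψ γ (A.map h a) = ψ β a) :
    A.Completion →* K :=
  PresentedGroup.toGroup (f := fun x : Σ β, A.grp β => ψ x.1 x.2) (by
    rintro r (⟨β, a, b⟩ | ⟨h, a⟩)
    · simp
    · simp [hψ h a])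

/-- The amalgam formed by a monotone family of subgroups of a group `G`, with the inclusions. -/
def ofSubgroups {G : Type w} [Group G] (H : B → Subgroup G) (hH : Monotone H) :
    Amalgam.{v, w} B where
  grp β := H β
  map h := Subgroup.inclusion (hH h.le)
  map_map _ _ _ := rfl

/-- `G` is the universal completion of the amalgam formed by its subgroups `H β`: the homomorphism
to `G` from the universal completion of this amalgam that extends all the inclusions `H β → G` is
an isomorphism. -/
def IsUniversalCompletion {G : Type w} [Group G] (H : B → Subgroup G) (hH : Monotone H) : Prop :=
  Function.Bijective
    ((ofSubgroups H hH).lift (fun β => (H β).subtype) (fun _ _ => rfl))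

end Amalgam

/-! ### The symplectic groups and their action on column vectors -/

namespace Symp

variable (F : Type u) [Field F]

/-- `Sp_{2n}(F)` as a group of matrices, the coordinates being labelled by `Fin n ⊕ Fin n`. -/
abbrev Sp (n : ℕ) : Type u := ↥(Matrix.symplecticGroup (Fin n) F)

variable {F}

/-- The standard symplectic form on `F^{2n}`. -/
def form {n : ℕ} (x y : Fin n ⊕ Fin n → F) : F :=
  ∑ i, (x (Sum.inl i) * y (Sum.inr i) - x (Sum.inr i) * y (Sum.inl i))

theorem form_eq {n : ℕ} (x y : Fin n ⊕ Fin n → F) : form x y = -(x ⬝ᵥ (J (Fin n) F *ᵥ y)) := by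
  have h : J (Fin n) F *ᵥ y = Sum.elim (fun i => -y (Sum.inr i)) (fun i => y (Sum.inl i)) := by
    conv_lhs => rw [← Sum.elim_comp_inl_inr y]
    rw [J, fromBlocks_mulVec]
    simp [Function.comp_def, neg_mulVec]
    rfl
  rw [h]
  simp [form, dotProduct, Finset.sum_add_distrib, sub_eq_neg_add]

theorem form_mulVec {n : ℕ} (g : Sp F n) (x y : Fin n ⊕ Fin n → F) :
    form (g.1 *ᵥ x) (g.1 *ᵥ y) = form x y := by
  rw [form_eq, form_eq, dotProduct_mulVec, dotProduct_mulVec, ← vecMul_transpose, vecMul_vecMul,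
    dotProduct_mulVec, vecMul_vecMul, ← Matrix.mul_assoc, SymplecticGroup.mem_iff'.1 g.2]

theorem form_add_left {n : ℕ} (x y z : Fin n ⊕ Fin n → F) :
    form (x + y) z = form x z + form y z := by
  simp only [form, ← Finset.sum_add_distrib, Pi.add_apply]
  exact Finset.sum_congr rfl fun _ _ => by ring

theorem form_add_right {n : ℕ} (x y z : Fin n ⊕ Fin n → F) :
    form x (y + z) = form x y + form x z := by
  simp only [form, ← Finset.sum_add_distrib, Pi.add_apply]
  exact Finset.sum_congr rfl fun _ _ => by ring

theorem form_self {n : ℕ} (x : Fin n ⊕ Fin n → F) : form x x = 0 :=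
  Finset.sum_eq_zero fun _ _ => by ring

theorem form_neg_left {n : ℕ} (x y : Fin n ⊕ Fin n → F) : form (-x) y = -form x y := by
  simp only [form, ← Finset.sum_neg_distrib, Pi.neg_apply]
  exact Finset.sum_congr rfl fun _ _ => by ring

/-- The subgroup of `Sp_{2n}(F)` of all elements that fix every vector of `A` and stabilize the
subspace `W`. -/
def stab {n : ℕ} (A : Set (Fin n ⊕ Fin n → F)) (W : Submodule F (Fin n ⊕ Fin n → F)) :
    Subgroup (Sp F n) where
  carrier := {g | (∀ x ∈ A, g.1 *ᵥ x = x) ∧ W.map g.1.mulVecLin = W}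
  one_mem' := by
    refine ⟨fun x _ => by simp, ?_⟩
    change W.map (1 : Matrix (Fin n ⊕ Fin n) (Fin n ⊕ Fin n) F).mulVecLin = W
    rw [mulVecLin_one, Submodule.map_id]
  mul_mem' := by
    rintro g h ⟨hg, hg'⟩ ⟨hh, hh'⟩
    refine ⟨fun x hx => ?_, ?_⟩
    · change (g.1 * h.1) *ᵥ x = x
      rw [← mulVec_mulVec, hh x hx, hg x hx]
    · change W.map (g.1 * h.1).mulVecLin = W
      rw [mulVecLin_mul, Submodule.map_comp, hh', hg']
  inv_mem' := by
    rintro g ⟨hg, hg'⟩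
    have key : (g⁻¹).1 * g.1 = 1 := congrArg Subtype.val (inv_mul_cancel g)
    refine ⟨fun x hx => ?_, ?_⟩
    · conv_lhs => rw [← hg x hx]
      rw [mulVec_mulVec, key, one_mulVec]
    · conv_lhs => rw [← hg']
      rw [← Submodule.map_comp, ← mulVecLin_mul, key, mulVecLin_one, Submodule.map_id]

variable (F)

/-! ### The subgroups of `Sp_4(F)`; the indices `1, 2` are `0, 1 : Fin 2` here -/

/-- The vectors `e_1, e_2` of the standard hyperbolic basis of `F^4`. -/
def e (i : Fin 2) : Fin 2 ⊕ Fin 2 → F := Pi.single (Sum.inl i) 1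

/-- The vectors `f_1, f_2` of the standard hyperbolic basis of `F^4`. -/
def f (i : Fin 2) : Fin 2 ⊕ Fin 2 → F := Pi.single (Sum.inr i) 1

/-- The hyperbolic basis `{e_1, f_1, e_2, f_2}` of `F^4`. -/
def basis : Set (Fin 2 ⊕ Fin 2 → F) := {e F 0, f F 0, e F 1, f F 1}

/-- `S_i`: the elements that fix all basis vectors other than `e_i, f_i` and stabilize the subspace
spanned by `e_i` and `f_i`. -/
def S (i : Fin 2) : Subgroup (Sp F 2) :=
  stab (basis F \ {e F i, f F i}) (Submodule.span F {e F i, f F i})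

/-- `M_1`: the elements that fix all basis vectors other than `f_1, f_2` and stabilize the subspace
spanned by `e_1, f_1, e_2, f_2`. -/
def M : Subgroup (Sp F 2) :=
  stab (basis F \ {f F 0, f F 1}) (Submodule.span F {e F 0, f F 0, e F 1, f F 1})

/-- `S_{12}`, generated by `S_1` and `S_2`. -/
def S12 : Subgroup (Sp F 2) := Subgroup.closure (S F 0 ∪ S F 1)

/-- `Q_{11}`, generated by `M_1` and `S_1`. -/
def Q11 : Subgroup (Sp F 2) := Subgroup.closure (M F ∪ S F 0)

/-- `Q_{12}`, generated by `M_1` and `S_2`. -/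
def Q12 : Subgroup (Sp F 2) := Subgroup.closure (M F ∪ S F 1)

/-- The six members of the amalgam. -/
inductive Node
  | S1 | S2 | M1 | S12 | Q11 | Q12

/-- The generators among `S_1` (`0`), `M_1` (`1`), `S_2` (`2`) of each member. -/
def Node.gens : Node → Finset (Fin 3)
  | .S1 => {0}
  | .M1 => {1}
  | .S2 => {2}
  | .S12 => {0, 2}
  | .Q11 => {0, 1}
  | .Q12 => {1, 2}

theorem Node.gens_injective : Function.Injective Node.gens := by
  intro a b h
  cases a <;> cases b <;> first | rfl | exact absurd h (by decide)

/-- The strict relations are `S1, S2 < S12`, `M1, S1 < Q11` and `M1, S2 < Q12`. -/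
instance : PartialOrder Node := PartialOrder.lift Node.gens Node.gens_injective

theorem Node.le_def (a b : Node) : a ≤ b ↔ a.gens ⊆ b.gens := Iff.rfl

/-- The subgroup of `Sp_4(F)` named by each member of the amalgam. -/
def slim : Node → Subgroup (Sp F 2)
  | .S1 => S F 0
  | .S2 => S F 1
  | .M1 => M F
  | .S12 => S12 F
  | .Q11 => Q11 F
  | .Q12 => Q12 F

theorem slim_monotone : Monotone (slim F) := by
  intro a b h
  rw [Node.le_def] at h
  cases a <;> cases b <;> first
    | exact le_rfl
    | exact absurd h (by decide)
    | exact fun x hx => Subgroup.subset_closure (Or.inl hx)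
    | exact fun x hx => Subgroup.subset_closure (Or.inr hx)

/-! ### The group `V = F . F^2` and its semidirect product with `Sp_2(F)` -/

/-- The set `F^2 × F`, with the multiplication `(x, b) (y, c) = (x + y, b + c + s(x, y))`, where `s`
is the symplectic form on `F^2`. -/
@[ext]
structure Heis where
  vec : Fin 1 ⊕ Fin 1 → F
  z : F

namespace Heis

variable {F}

instance : Mul (Heis F) := ⟨fun x y => ⟨x.vec + y.vec, x.z + y.z + form x.vec y.vec⟩⟩
instance : One (Heis F) := ⟨⟨0, 0⟩⟩
instance : Inv (Heis F) := ⟨fun x => ⟨-x.vec, -x.z⟩⟩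

@[simp] theorem mul_vec (x y : Heis F) : (x * y).vec = x.vec + y.vec := rfl
@[simp] theorem mul_z (x y : Heis F) : (x * y).z = x.z + y.z + form x.vec y.vec := rfl
@[simp] theorem one_vec : (1 : Heis F).vec = 0 := rfl
@[simp] theorem one_z : (1 : Heis F).z = 0 := rfl
@[simp] theorem inv_vec (x : Heis F) : x⁻¹.vec = -x.vec := rfl
@[simp] theorem inv_z (x : Heis F) : x⁻¹.z = -x.z := rfl

instance : Group (Heis F) :=
  Group.ofLeftAxioms
    (fun x y t => Heis.ext (by simp [add_assoc])
      (by simp only [mul_z, mul_vec, form_add_left, form_add_right]; ring))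
    (fun x => Heis.ext (by simp) (by simp [form]))
    (fun x => Heis.ext (by simp) (by simp [form_neg_left, form_self]))

/-- The action of `Sp_2(F)` on `V`, by `g (x, b) = (g x, b)`. -/
def act : Sp F 1 →* MulAut (Heis F) where
  toFun g :=
    { toFun := fun x => ⟨g.1 *ᵥ x.vec, x.z⟩
      invFun := fun x => ⟨(g⁻¹).1 *ᵥ x.vec, x.z⟩
      left_inv := fun x => Heis.ext (by
        have key : (g⁻¹).1 * g.1 = 1 := congrArg Subtype.val (inv_mul_cancel g)
        simp only [mulVec_mulVec, key, one_mulVec]) rfl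
      right_inv := fun x => Heis.ext (by
        have key : g.1 * (g⁻¹).1 = 1 := congrArg Subtype.val (mul_inv_cancel g)
        simp only [mulVec_mulVec, key, one_mulVec]) rfl
      map_mul' := fun x y => Heis.ext (by simp [mulVec_add]) (by simp [form_mulVec]) }
  map_one' := by
    ext x : 1
    exact Heis.ext (one_mulVec x.vec) rfl
  map_mul' g h := by
    ext x : 1
    exact Heis.ext (mulVec_mulVec x.vec g.1 h.1).symm rfl

end Heis

end Symp

/-! The group G is transitive on nonzero vectors, and the stabilizer of e_2 is `Q11`. Split a vector
as u + v with u in ⟨e_1, f_1⟩ and v in ⟨e_2, f_2⟩. The block diagonal group `S12` has three orbits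
on nonzero vectors: u = 0, both parts nonzero, v = 0. So G is the union of three double cosets S12 ·
r · Q11, where r sends e_2 to e_2, e_1 + e_2 or e_1.

The completion K inherits this decomposition. The maps of `S12`, `Q11`, `Q12` into K agree on
overlaps and glue to a `PartialHom`. As K is generated by the images of `S12` and `M`, it suffices
that the union `T` of three double cosets in K is stable under left multiplication by the image of
`M` (`U_mul_mem_T`). The relations needed hold inside `Q11` or `Q12`, or arise from such relations
by conjugation with Weyl elements of `S12`. The crucial case is `U_mul_D_mul_X_mem_T`: a symmetric
2×2 matrix is a diagonal matrix plus a multiple of the rank one matrix with rows (1, -1), (-1, 1).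
The diagonal part is absorbed by the block diagonal group, and moving the rank one part past `X 1`
makes it diagonal as well, hence an element of `Q`.

If an element d r q of K maps to 1 in G, then d r fixes e_2, which forces r = 1 and d in `Q11`; the
relation d q = 1 then already holds in the image of `Q11`. The isomorphism types follow from
explicit parametrizations of the stabilizers. -/

namespace Symp

variable {F : Type u} [Field F]

/-! ### Elements of `Sp_2(F)` -/

theorem sp_one_det (g : Sp F 1) :
    g.1 (.inl 0) (.inl 0) * g.1 (.inr 0) (.inr 0) -
      g.1 (.inl 0) (.inr 0) * g.1 (.inr 0) (.inl 0) = 1 := by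
  have h := form_mulVec g (Pi.single (Sum.inl 0) 1) (Pi.single (Sum.inr 0) 1)
  simp [form] at h
  linear_combination h

/-- The element of `Sp_2(F)` with the given entries. -/
def sl (a b c d : F) (h : a * d - b * c = 1) : Sp F 1 :=
  ⟨fromBlocks !![a] !![b] !![c] !![d], by
    rw [SymplecticGroup.mem_iff, J, fromBlocks_transpose, fromBlocks_multiply, fromBlocks_multiply]
    ext (i | i) (j | j) <;> fin_cases i <;> fin_cases j <;>
      simp [Matrix.vecMul, dotProduct] <;>
      first | ring1 | linear_combination h | linear_combination -h⟩

theorem sp_one_ext {g h : Sp F 1} (h1 : g.1 (.inl 0) (.inl 0) = h.1 (.inl 0) (.inl 0))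
    (h2 : g.1 (.inl 0) (.inr 0) = h.1 (.inl 0) (.inr 0))
    (h3 : g.1 (.inr 0) (.inl 0) = h.1 (.inr 0) (.inl 0))
    (h4 : g.1 (.inr 0) (.inr 0) = h.1 (.inr 0) (.inr 0)) : g = h := by
  apply Subtype.ext
  ext (i | i) (j | j) <;> fin_cases i <;> fin_cases j <;> assumption

theorem sp_one_mul_apply (g h : Sp F 1) (i j : Fin 1 ⊕ Fin 1) :
    (g * h).1 i j = g.1 i (.inl 0) * h.1 (.inl 0) j + g.1 i (.inr 0) * h.1 (.inr 0) j := by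
  change (g.1 * h.1) i j = _
  simp [Matrix.mul_apply]

theorem sl_mul (a b c d a' b' c' d' : F) (h : a * d - b * c = 1) (h' : a' * d' - b' * c' = 1) :
    sl a b c d h * sl a' b' c' d' h' = sl (a * a' + b * c') (a * b' + b * d')
      (c * a' + d * c') (c * b' + d * d') (by linear_combination h' + (a' * d' - b' * c') * h) := by
  apply sp_one_ext <;> simp [sl, Matrix.mul_apply]

theorem sl_one : sl (1 : F) 0 0 1 (by simp) = 1 := by
  apply sp_one_ext <;> simp [sl]

/-- The upper unitriangular element of `Sp_2(F)`. -/
def up (t : F) : Sp F 1 := sl 1 t 0 1 (by simp)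

/-- The lower unitriangular element of `Sp_2(F)`. -/
def lo (t : F) : Sp F 1 := sl 1 0 t 1 (by simp)

/-- The diagonal element of `Sp_2(F)`. -/
def dg (a : Fˣ) : Sp F 1 := sl a 0 0 ↑a⁻¹ (by simp)

/-- The standard representative of the nontrivial element of the Weyl group of `Sp_2(F)`. -/
def wy : Sp F 1 := sl 0 1 (-1) 0 (by simp)

theorem wy_inv : (wy : Sp F 1)⁻¹ = sl 0 (-1) 1 0 (by simp) := by
  rw [inv_eq_iff_mul_eq_one, wy, sl_mul, ← sl_one]; apply sp_one_ext <;> simp [sl]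

theorem dg_inv (a : Fˣ) : (dg a)⁻¹ = dg a⁻¹ := by
  rw [inv_eq_iff_mul_eq_one, dg, dg, sl_mul, ← sl_one]; apply sp_one_ext <;> simp [sl]

/-- An element with nonzero lower left entry lies in the big cell. -/
theorem eq_up_wy_dg_up (g : Sp F 1) (c : Fˣ) (hc : g.1 (.inr 0) (.inl 0) = c) :
    g = up (g.1 (.inl 0) (.inl 0) * ↑c⁻¹) * wy⁻¹ * dg c *
      up (g.1 (.inr 0) (.inr 0) * ↑c⁻¹) := by
  have h := sp_one_det g
  have h0 := c.ne_zero
  rw [wy_inv, up, up, dg, sl_mul, sl_mul, sl_mul]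
  apply sp_one_ext <;> simp [sl, hc]
  · field_simp
    rw [hc] at h
    linear_combination -h
  · field_simp

theorem eq_up_lo_up (g : Sp F 1) (hc : g.1 (.inr 0) (.inl 0) ≠ 0) :
    ∃ p c t, g = up p * lo c * up t := by
  have h := sp_one_det g
  refine ⟨(g.1 (.inl 0) (.inl 0) - 1) / g.1 (.inr 0) (.inl 0), g.1 (.inr 0) (.inl 0),
    (g.1 (.inr 0) (.inr 0) - 1) / g.1 (.inr 0) (.inl 0), ?_⟩
  rw [up, up, lo, sl_mul, sl_mul]
  apply sp_one_ext <;> simp [sl] <;> field_simp <;> try ring1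
  linear_combination -h

/-- `Sp_2(F)` is generated by the unitriangular elements. -/
theorem sp_one_induction {P : Sp F 1 → Prop} (hup : ∀ t, P (up t)) (hlo : ∀ t, P (lo t))
    (hmul : ∀ g h, P g → P h → P (g * h)) (g : Sp F 1) : P g := by
  have key : ∀ g : Sp F 1, g.1 (.inr 0) (.inl 0) ≠ 0 → P g := by
    intro g hg
    obtain ⟨p, c, t, rfl⟩ := eq_up_lo_up g hg
    exact hmul _ _ (hmul _ _ (hup _) (hlo _)) (hup _)
  by_cases hg : g.1 (.inr 0) (.inl 0) = 0
  · have h := sp_one_det g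
    -- Multiplying by `lo 1` adds the lower right entry to the vanishing lower left one, and the
    -- determinant makes that entry nonzero.
    have h1 : g = g * lo 1 * lo (-1) := by
      rw [mul_assoc, lo, lo, sl_mul]
      simp [sl_one]
    rw [h1]
    refine hmul _ _ (key _ ?_) (hlo _)
    intro h2
    simp [lo, sl, Matrix.mul_apply, hg] at h2
    simp [hg, h2] at h
  · exact key g hg

/-- An element with vanishing lower left entry is upper triangular. -/
theorem eq_up_dg (g : Sp F 1) (hc : g.1 (.inr 0) (.inl 0) = 0) : ∃ p a, g = up p * dg a := by
  have h := sp_one_det g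
  rw [hc, mul_zero, sub_zero] at h
  refine ⟨g.1 (.inl 0) (.inr 0) * g.1 (.inl 0) (.inl 0), ⟨g.1 (.inl 0) (.inl 0), g.1 (.inr 0) (.inr 0), h,
    by rw [mul_comm, h]⟩, ?_⟩
  rw [up, dg, sl_mul]
  apply sp_one_ext <;> simp [sl, hc]
  rw [mul_assoc, h, mul_one]

theorem exists_col (a c : F) (h : a ≠ 0 ∨ c ≠ 0) :
    ∃ g : Sp F 1, g.1 (.inl 0) (.inl 0) = a ∧ g.1 (.inr 0) (.inl 0) = c := by
  by_cases ha : a = 0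
  · have hc : c ≠ 0 := by tauto
    exact ⟨sl a (-c⁻¹) c 0 (by simp [hc]), rfl, rfl⟩
  · exact ⟨sl a 0 c a⁻¹ (by simp [ha]), rfl, rfl⟩

/-! ### Elements of `Sp_4(F)` -/

/-- The block diagonal element of `Sp_4(F)` with two given blocks. -/
def blk (g h : Sp F 1) : Sp F 2 :=
  ⟨fromBlocks !![g.1 (.inl 0) (.inl 0), 0; 0, h.1 (.inl 0) (.inl 0)]
      !![g.1 (.inl 0) (.inr 0), 0; 0, h.1 (.inl 0) (.inr 0)]
      !![g.1 (.inr 0) (.inl 0), 0; 0, h.1 (.inr 0) (.inl 0)]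
      !![g.1 (.inr 0) (.inr 0), 0; 0, h.1 (.inr 0) (.inr 0)], by
    have h1 := sp_one_det g
    have h2 := sp_one_det h
    rw [SymplecticGroup.mem_iff, J, fromBlocks_transpose, fromBlocks_multiply, fromBlocks_multiply]
    ext (i | i) (j | j) <;> fin_cases i <;> fin_cases j <;>
      simp [Matrix.vecMul, dotProduct] <;>
      first | ring1 | linear_combination h1 | linear_combination h2 | linear_combination -h1 |
        linear_combination -h2⟩

theorem blk_mul (g h g' h' : Sp F 1) : blk g h * blk g' h' = blk (g * g') (h * h') := by
  apply Subtype.ext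
  simp only [blk, sp_one_mul_apply, Submonoid.mk_mul_mk, fromBlocks_multiply]
  congr 1 <;> ext i j <;> fin_cases i <;> fin_cases j <;> simp

theorem blk_one : blk (1 : Sp F 1) 1 = 1 := by
  apply Subtype.ext
  ext (i | i) (j | j) <;> fin_cases i <;> fin_cases j <;> simp [blk]

/-- The block diagonal embedding `Sp_2(F) × Sp_2(F) → Sp_4(F)`. -/
def emb : Sp F 1 × Sp F 1 →* Sp F 2 where
  toFun p := blk p.1 p.2
  map_one' := blk_one
  map_mul' p q := (blk_mul p.1 p.2 q.1 q.2).symm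

/-- The elements of `Sp_4(F)` that fix `e_1` and `e_2`. -/
def mm (p q r : F) : Sp F 2 :=
  ⟨fromBlocks 1 !![p, q; q, r] 0 1, by
    rw [SymplecticGroup.mem_iff, J, fromBlocks_transpose, fromBlocks_multiply, fromBlocks_multiply]
    ext (i | i) (j | j) <;> fin_cases i <;> fin_cases j <;>
      simp⟩

/-- The elements of `Sp_4(F)` that map `e_2` to `e_2 + t e_1` and `f_1` to `f_1 - t f_2`. -/
def xa (t : F) : Sp F 2 :=
  ⟨fromBlocks !![1, t; 0, 1] 0 0 !![1, 0; -t, 1], by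
    rw [SymplecticGroup.mem_iff, J, fromBlocks_transpose, fromBlocks_multiply, fromBlocks_multiply]
    ext (i | i) (j | j) <;> fin_cases i <;> fin_cases j <;>
      simp [Matrix.vecMul, dotProduct]⟩

/-- The elements of `Sp_4(F)` that map `e_1` to `e_1 + t e_2` and `f_2` to `f_2 - t f_1`. -/
def xb (t : F) : Sp F 2 :=
  ⟨fromBlocks !![1, 0; t, 1] 0 0 !![1, -t; 0, 1], by
    rw [SymplecticGroup.mem_iff, J, fromBlocks_transpose, fromBlocks_multiply, fromBlocks_multiply]
    ext (i | i) (j | j) <;> fin_cases i <;> fin_cases j <;>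
      simp [Matrix.vecMul, dotProduct]⟩

theorem mm_mul (p q r p' q' r' : F) : mm p q r * mm p' q' r' = mm (p + p') (q + q') (r + r') := by
  apply Subtype.ext
  ext (i | i) (j | j) <;> fin_cases i <;> fin_cases j <;> simp [Matrix.mul_apply, mm, add_comm]

theorem blk_up (p r : F) : blk (up p) (up r) = mm p 0 r := by
  apply Subtype.ext
  ext (i | i) (j | j) <;> fin_cases i <;> fin_cases j <;> simp [blk, mm, up, sl]

theorem blk_dg_mul_mm (a b : Fˣ) (p q r : F) :
    blk (dg a) (dg b) * mm p q r = mm (a ^ 2 * p) (a * b * q) (b ^ 2 * r) * blk (dg a) (dg b) := by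
  apply Subtype.ext
  ext (i | i) (j | j) <;> fin_cases i <;> fin_cases j <;>
    simp [Matrix.mul_apply, mm, blk, dg, sl] <;> field_simp

theorem xa_mul_mm (t p q r : F) :
    xa t * mm p q r = mm (p + 2 * t * q + t ^ 2 * r) (q + t * r) r * xa t := by
  apply Subtype.ext
  ext (i | i) (j | j) <;> fin_cases i <;> fin_cases j <;>
    simp [Matrix.mul_apply, mm, xa] <;> ring

theorem xb_mul_mm (t p q r : F) :
    xb t * mm p q r = mm p (q + t * p) (r + 2 * t * q + t ^ 2 * p) * xb t := by
  apply Subtype.ext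
  ext (i | i) (j | j) <;> fin_cases i <;> fin_cases j <;>
    simp [Matrix.mul_apply, mm, xb] <;> ring

theorem blk_wy_right_mul (q : F) : blk 1 wy * mm 0 q 0 = xa q * blk 1 wy := by
  apply Subtype.ext
  ext (i | i) (j | j) <;> fin_cases i <;> fin_cases j <;>
    simp [Matrix.mul_apply, mm, xa, blk, wy, sl]

theorem blk_wy_left_mul (q : F) : blk wy 1 * mm 0 q 0 = xb q * blk wy 1 := by
  apply Subtype.ext
  ext (i | i) (j | j) <;> fin_cases i <;> fin_cases j <;>
    simp [Matrix.mul_apply, mm, xb, blk, wy, sl]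

theorem mm_mul_blk_wy_right (q : F) : mm 0 q 0 * blk 1 wy = blk 1 wy * xa (-q) := by
  apply Subtype.ext
  ext (i | i) (j | j) <;> fin_cases i <;> fin_cases j <;>
    simp [Matrix.mul_apply, mm, xa, blk, wy, sl]

theorem mm_mul_blk_wy_left (q : F) : mm 0 q 0 * blk wy 1 = blk wy 1 * xb (-q) := by
  apply Subtype.ext
  ext (i | i) (j | j) <;> fin_cases i <;> fin_cases j <;>
    simp [Matrix.mul_apply, mm, xb, blk, wy, sl]

theorem wy_mul_up (t : F) : wy * up (-t) = lo t * wy := by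
  rw [wy, up, lo, sl_mul, sl_mul]; apply sp_one_ext <;> simp [sl]

theorem wy_mul_dg (a : Fˣ) : dg a * wy = wy * dg a⁻¹ := by
  rw [wy, dg, dg, sl_mul, sl_mul]; apply sp_one_ext <;> simp [sl]

/-! ### The subgroups of the amalgam in coordinates -/

theorem mul_mulVec {n : ℕ} (g h : Sp F n) (x : Fin n ⊕ Fin n → F) :
    (g * h).1 *ᵥ x = g.1 *ᵥ (h.1 *ᵥ x) :=
  (mulVec_mulVec x g.1 h.1).symm

theorem one_mulVec' {n : ℕ} (x : Fin n ⊕ Fin n → F) : (1 : Sp F n).1 *ᵥ x = x :=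
  one_mulVec x

theorem inv_mul_mulVec_eq_iff {n : ℕ} (g h : Sp F n) (x : Fin n ⊕ Fin n → F) :
    (g⁻¹ * h).1 *ᵥ x = x ↔ h.1 *ᵥ x = g.1 *ᵥ x := by
  constructor
  · intro H
    conv_rhs => rw [← H, ← mul_mulVec, mul_inv_cancel_left]
  · intro H
    rw [mul_mulVec, H, ← mul_mulVec, inv_mul_cancel, one_mulVec']

/-- The symplectic relation between two columns; once one column is a basis vector, it determines an
entry of the other. -/
theorem form_col (g : Sp F 2) (k l : Fin 2 ⊕ Fin 2) :
    g.1 (.inl 0) k * g.1 (.inr 0) l - g.1 (.inr 0) k * g.1 (.inl 0) l +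
      (g.1 (.inl 1) k * g.1 (.inr 1) l - g.1 (.inr 1) k * g.1 (.inl 1) l) =
    form (Pi.single k 1) (Pi.single l (1 : F)) := by
  rw [← form_mulVec g]
  simp [form]
  ring

theorem mulVec_e (g : Sp F 2) (i : Fin 2) : g.1 *ᵥ e F i = fun k => g.1 k (.inl i) := by
  simp only [e, mulVec_single_one]; rfl

theorem mulVec_f (g : Sp F 2) (i : Fin 2) : g.1 *ᵥ f F i = fun k => g.1 k (.inr i) := by
  simp only [f, mulVec_single_one]; rfl

/-- Pairing with the fixed e_1, e_2 forces the lower right block to be 1; pairing the two f-columns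
forces the upper right block to be symmetric. -/
theorem eq_mm {g : Sp F 2} (h0 : g.1 *ᵥ e F 0 = e F 0) (h1 : g.1 *ᵥ e F 1 = e F 1) :
    ∃ p q r, g = mm p q r := by
  rw [mulVec_e] at h0 h1
  have c0 := fun k => congrFun h0 k
  have c1 := fun k => congrFun h1 k
  have f00 := form_col g (.inl 0) (.inr 0)
  have f01 := form_col g (.inl 0) (.inr 1)
  have f10 := form_col g (.inl 1) (.inr 0)
  have f11 := form_col g (.inl 1) (.inr 1)
  have ff := form_col g (.inr 0) (.inr 1)
  simp [c0, c1, form, e] at f00 f01 f10 f11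
  simp [form, f00, f01, f10, f11] at ff
  refine ⟨g.1 (.inl 0) (.inr 0), g.1 (.inl 0) (.inr 1), g.1 (.inl 1) (.inr 1), ?_⟩
  apply Subtype.ext
  ext (i | i) (j | j) <;> fin_cases i <;> fin_cases j <;>
    simp [c0, c1, e, mm, f00, f01, f10, f11]
  linear_combination ff

/-- Since g preserves the orthogonal complement of e_1, it induces some h in Sp_2 on ⟨e_2, f_2⟩
modulo e_1. With a the e_1-coordinate of g e_2, the element `blk 1 h * xa a` agrees with g on e_1
and e_2, so `eq_mm` applies to the quotient. -/
theorem exists_eq_of_fix_e0 {g : Sp F 2} (h0 : g.1 *ᵥ e F 0 = e F 0) :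
    ∃ h a p q r, g = blk 1 h * xa a * mm p q r := by
  have h0' := h0
  rw [mulVec_e] at h0
  have c0 := fun k => congrFun h0 k
  have f01 := form_col g (.inl 0) (.inr 1)
  have f10 := form_col g (.inl 0) (.inl 1)
  have f11 := form_col g (.inl 1) (.inr 1)
  simp [c0, form, e] at f01 f10
  simp [form, f01, f10] at f11
  let h : Sp F 1 := sl (g.1 (.inl 1) (.inl 1)) (g.1 (.inl 1) (.inr 1)) (g.1 (.inr 1) (.inl 1))
    (g.1 (.inr 1) (.inr 1)) (by linear_combination f11)
  obtain ⟨p, q, r, H⟩ := eq_mm (g := (blk 1 h * xa (g.1 (.inl 0) (.inl 1)))⁻¹ * g)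
    (by
      rw [inv_mul_mulVec_eq_iff, h0', mul_mulVec]
      ext (i | i) <;> fin_cases i <;> simp [xa, blk, e, mulVec, dotProduct])
    (by
      rw [inv_mul_mulVec_eq_iff, mul_mulVec]
      ext (i | i) <;> fin_cases i <;> simp [xa, blk, e, mulVec, dotProduct, h, sl, f10])
  exact ⟨h, _, p, q, r, by rw [← H, mul_inv_cancel_left]⟩

theorem exists_eq_of_fix_e1 {g : Sp F 2} (h0 : g.1 *ᵥ e F 1 = e F 1) :
    ∃ h a p q r, g = blk h 1 * xb a * mm p q r := by
  have h0' := h0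
  rw [mulVec_e] at h0
  have c0 := fun k => congrFun h0 k
  have f01 := form_col g (.inl 1) (.inr 0)
  have f10 := form_col g (.inl 1) (.inl 0)
  have f11 := form_col g (.inl 0) (.inr 0)
  simp [c0, form, e] at f01 f10
  simp [form, f01, f10] at f11
  let h : Sp F 1 := sl (g.1 (.inl 0) (.inl 0)) (g.1 (.inl 0) (.inr 0)) (g.1 (.inr 0) (.inl 0))
    (g.1 (.inr 0) (.inr 0)) (by linear_combination f11)
  obtain ⟨p, q, r, H⟩ := eq_mm (g := (blk h 1 * xb (g.1 (.inl 1) (.inl 0)))⁻¹ * g)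
    (by
      rw [inv_mul_mulVec_eq_iff, mul_mulVec]
      ext (i | i) <;> fin_cases i <;> simp [xb, blk, e, mulVec, dotProduct, h, sl, f10])
    (by
      rw [inv_mul_mulVec_eq_iff, h0', mul_mulVec]
      ext (i | i) <;> fin_cases i <;> simp [xb, blk, e, mulVec, dotProduct])
  exact ⟨h, _, p, q, r, by rw [← H, mul_inv_cancel_left]⟩

theorem mem_stab_span {A B : Set (Fin 2 ⊕ Fin 2 → F)} {g : Sp F 2}
    (hA : ∀ x ∈ A, g.1 *ᵥ x = x)
    (hB : ∀ x ∈ B, g.1 *ᵥ x ∈ Submodule.span F B)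
    (hB' : ∀ x ∈ B, (g⁻¹).1 *ᵥ x ∈ Submodule.span F B) :
    g ∈ stab A (Submodule.span F B) := by
  refine ⟨hA, le_antisymm ?_ ?_⟩
  · rw [Submodule.map_span, Submodule.span_le]
    rintro _ ⟨x, hx, rfl⟩
    exact hB x hx
  · rw [Submodule.span_le]
    intro x hx
    refine ⟨_, hB' x hx, ?_⟩
    change g.1 *ᵥ ((g⁻¹).1 *ᵥ x) = x
    rw [← mul_mulVec, mul_inv_cancel, one_mulVec']

theorem e_ne_f (i j : Fin 2) : e F i ≠ f F j := by
  intro h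
  simpa [e, f] using congrFun h (.inl i)

theorem e_ne_e {i j : Fin 2} (hij : i ≠ j) : e F i ≠ e F j := by
  intro h
  simpa [e, hij] using congrFun h (.inl i)

theorem f_ne_f {i j : Fin 2} (hij : i ≠ j) : f F i ≠ f F j := by
  intro h
  simpa [f, hij] using congrFun h (.inr i)

theorem mem_M {g : Sp F 2} : g ∈ M F ↔ g.1 *ᵥ e F 0 = e F 0 ∧ g.1 *ᵥ e F 1 = e F 1 := by
  constructor
  · intro h
    exact ⟨h.1 _ ⟨by simp [basis], by simp [e_ne_f]⟩, h.1 _ ⟨by simp [basis], by simp [e_ne_f]⟩⟩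
  · rintro ⟨h0, h1⟩
    have key : ∀ x : Fin 2 ⊕ Fin 2 → F,
        x ∈ Submodule.span F {e F 0, f F 0, e F 1, f F 1} := by
      intro x
      have : x = x (.inl 0) • e F 0 + x (.inr 0) • f F 0 + x (.inl 1) • e F 1 +
          x (.inr 1) • f F 1 := by
        ext (i | i) <;> fin_cases i <;> simp [e, f]
      rw [this]
      refine add_mem (add_mem (add_mem ?_ ?_) ?_) ?_ <;>
        exact Submodule.smul_mem _ _ (Submodule.subset_span (by simp))
    refine mem_stab_span ?_ (fun _ _ => key _) (fun _ _ => key _)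
    rintro x ⟨hx, hx'⟩
    rcases hx with rfl | rfl | rfl | rfl
    · exact h0
    · simp at hx'
    · exact h1
    · simp at hx'

theorem blk_inv (g h : Sp F 1) : (blk g h)⁻¹ = blk g⁻¹ h⁻¹ := by
  rw [inv_eq_iff_mul_eq_one, blk_mul, mul_inv_cancel, mul_inv_cancel, blk_one]

theorem blk_mul_vec (g h : Sp F 1) :
    (blk g h).1 *ᵥ e F 0 = g.1 (.inl 0) (.inl 0) • e F 0 + g.1 (.inr 0) (.inl 0) • f F 0 ∧
    (blk g h).1 *ᵥ f F 0 = g.1 (.inl 0) (.inr 0) • e F 0 + g.1 (.inr 0) (.inr 0) • f F 0 ∧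
    (blk g h).1 *ᵥ e F 1 = h.1 (.inl 0) (.inl 0) • e F 1 + h.1 (.inr 0) (.inl 0) • f F 1 ∧
    (blk g h).1 *ᵥ f F 1 = h.1 (.inl 0) (.inr 0) • e F 1 + h.1 (.inr 0) (.inr 0) • f F 1 := by
  refine ⟨?_, ?_, ?_, ?_⟩ <;> ext (i | i) <;> fin_cases i <;>
    simp [blk, e, f]

theorem mem_span_pair_of {a b : F} {x y : Fin 2 ⊕ Fin 2 → F} :
    a • x + b • y ∈ Submodule.span F {x, y} :=
  Submodule.mem_span_pair.2 ⟨a, b, rfl⟩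

theorem mem_S_zero {g : Sp F 2} : g ∈ S F 0 ↔ ∃ a, g = blk a 1 := by
  constructor
  · intro h
    have h0 := h.1 (e F 1) ⟨by simp [basis], by simp [e_ne_f, e_ne_e]⟩
    have h1 := h.1 (f F 1) ⟨by simp [basis], by simp [(e_ne_f _ _).symm, f_ne_f]⟩
    rw [mulVec_e] at h0
    rw [mulVec_f] at h1
    have c0 := fun k => congrFun h0 k
    have c1 := fun k => congrFun h1 k
    have f00 := form_col g (.inl 0) (.inl 1)
    have f01 := form_col g (.inl 0) (.inr 1)
    have f10 := form_col g (.inr 0) (.inl 1)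
    have f11 := form_col g (.inr 0) (.inr 1)
    have ff := form_col g (.inl 0) (.inr 0)
    simp [c0, c1, form, e, f] at f00 f01 f10 f11
    simp [form, f00, f01, f10, f11] at ff
    refine ⟨sl (g.1 (.inl 0) (.inl 0)) (g.1 (.inl 0) (.inr 0)) (g.1 (.inr 0) (.inl 0))
      (g.1 (.inr 0) (.inr 0)) (by linear_combination ff), ?_⟩
    apply Subtype.ext
    ext (i | i) (j | j) <;> fin_cases i <;> fin_cases j <;>
      simp [c0, c1, e, f, blk, sl, f00, f01, f10, f11]
  · rintro ⟨a, rfl⟩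
    refine mem_stab_span ?_ ?_ ?_
    · rintro x ⟨hx, hx'⟩
      rcases hx with rfl | rfl | rfl | rfl
      · simp at hx'
      · simp at hx'
      · simp [blk_mul_vec]
      · simp [blk_mul_vec]
    · rintro x (rfl | rfl) <;> simp only [blk_mul_vec] <;> exact mem_span_pair_of
    · rw [blk_inv]
      rintro x (rfl | rfl) <;> simp only [blk_mul_vec] <;> exact mem_span_pair_of

theorem mem_S_one {g : Sp F 2} : g ∈ S F 1 ↔ ∃ a, g = blk 1 a := by
  constructor
  · intro h
    have h0 := h.1 (e F 0) ⟨by simp [basis], by simp [e_ne_f, e_ne_e]⟩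
    have h1 := h.1 (f F 0) ⟨by simp [basis], by simp [(e_ne_f _ _).symm, f_ne_f]⟩
    rw [mulVec_e] at h0
    rw [mulVec_f] at h1
    have c0 := fun k => congrFun h0 k
    have c1 := fun k => congrFun h1 k
    have f00 := form_col g (.inl 1) (.inl 0)
    have f01 := form_col g (.inl 1) (.inr 0)
    have f10 := form_col g (.inr 1) (.inl 0)
    have f11 := form_col g (.inr 1) (.inr 0)
    have ff := form_col g (.inl 1) (.inr 1)
    simp [c0, c1, form, e, f] at f00 f01 f10 f11
    simp [form, f00, f01, f10, f11] at ff
    refine ⟨sl (g.1 (.inl 1) (.inl 1)) (g.1 (.inl 1) (.inr 1)) (g.1 (.inr 1) (.inl 1))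
      (g.1 (.inr 1) (.inr 1)) (by linear_combination ff), ?_⟩
    apply Subtype.ext
    ext (i | i) (j | j) <;> fin_cases i <;> fin_cases j <;>
      simp [c0, c1, e, f, blk, sl, f00, f01, f10, f11]
  · rintro ⟨a, rfl⟩
    refine mem_stab_span ?_ ?_ ?_
    · rintro x ⟨hx, hx'⟩
      rcases hx with rfl | rfl | rfl | rfl
      · simp [blk_mul_vec]
      · simp [blk_mul_vec]
      · simp at hx'
      · simp at hx'
    · rintro x (rfl | rfl) <;> simp only [blk_mul_vec] <;> exact mem_span_pair_of
    · rw [blk_inv]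
      rintro x (rfl | rfl) <;> simp only [blk_mul_vec] <;> exact mem_span_pair_of

/-- The stabilizer of a vector. -/
def fixer (x : Fin 2 ⊕ Fin 2 → F) : Subgroup (Sp F 2) where
  carrier := {g | g.1 *ᵥ x = x}
  one_mem' := one_mulVec' x
  mul_mem' {g h} hg hh := by
    change (g * h).1 *ᵥ x = x
    rw [mul_mulVec, show h.1 *ᵥ x = x from hh, show g.1 *ᵥ x = x from hg]
  inv_mem' {g} hg := by
    have := (inv_mul_mulVec_eq_iff g 1 x).2 (by rw [one_mulVec', show g.1 *ᵥ x = x from hg])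
    rwa [mul_one] at this

theorem mem_fixer {x : Fin 2 ⊕ Fin 2 → F} {g : Sp F 2} : g ∈ fixer x ↔ g.1 *ᵥ x = x := Iff.rfl

theorem mm_mem_M (p q r : F) : mm p q r ∈ M F := by
  rw [mem_M, mulVec_e, mulVec_e]
  constructor <;> ext (i | i) <;> fin_cases i <;> simp [mm, e]

/-- A Weyl element of S_2 conjugates a root group of M_1 to this one, which places it in `Q12`. -/
theorem xa_eq (q : F) : xa q = blk 1 wy * mm 0 q 0 * (blk 1 wy)⁻¹ := by
  rw [blk_wy_right_mul, mul_inv_cancel_right]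

theorem xb_eq (q : F) : xb q = blk wy 1 * mm 0 q 0 * (blk wy 1)⁻¹ := by
  rw [blk_wy_left_mul, mul_inv_cancel_right]

theorem Q11_eq_fixer : Q11 F = fixer (e F 1) := by
  apply le_antisymm
  · rw [Q11, Subgroup.closure_le]
    rintro g (hg | hg)
    · exact (mem_M.1 hg).2
    · obtain ⟨a, rfl⟩ := mem_S_zero.1 hg
      change _ *ᵥ _ = _
      simp [blk_mul_vec]
  · intro g hg
    have hM : ∀ p q r, mm p q r ∈ Q11 F := fun p q r =>
      Subgroup.subset_closure (Or.inl (mm_mem_M p q r))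
    have hS : ∀ h, blk h 1 ∈ Q11 F := fun h =>
      Subgroup.subset_closure (Or.inr (mem_S_zero.2 ⟨h, rfl⟩))
    obtain ⟨h, a, p, q, r, rfl⟩ := exists_eq_of_fix_e1 hg
    rw [xb_eq]
    exact mul_mem (mul_mem (hS _) (mul_mem (mul_mem (hS _) (hM _ _ _)) (inv_mem (hS _))))
      (hM _ _ _)

theorem Q12_eq_fixer : Q12 F = fixer (e F 0) := by
  apply le_antisymm
  · rw [Q12, Subgroup.closure_le]
    rintro g (hg | hg)
    · exact (mem_M.1 hg).1
    · obtain ⟨a, rfl⟩ := mem_S_one.1 hg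
      change _ *ᵥ _ = _
      simp [blk_mul_vec]
  · intro g hg
    have hM : ∀ p q r, mm p q r ∈ Q12 F := fun p q r =>
      Subgroup.subset_closure (Or.inl (mm_mem_M p q r))
    have hS : ∀ h, blk 1 h ∈ Q12 F := fun h =>
      Subgroup.subset_closure (Or.inr (mem_S_one.2 ⟨h, rfl⟩))
    obtain ⟨h, a, p, q, r, rfl⟩ := exists_eq_of_fix_e0 hg
    rw [xa_eq]
    exact mul_mem (mul_mem (hS _) (mul_mem (mul_mem (hS _) (hM _ _ _)) (inv_mem (hS _))))
      (hM _ _ _)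

theorem S12_eq_range : S12 F = (emb (F := F)).range := by
  apply le_antisymm
  · rw [S12, Subgroup.closure_le]
    rintro g (hg | hg)
    · obtain ⟨a, rfl⟩ := mem_S_zero.1 hg
      exact ⟨(a, 1), rfl⟩
    · obtain ⟨a, rfl⟩ := mem_S_one.1 hg
      exact ⟨(1, a), rfl⟩
  · rintro _ ⟨⟨a, b⟩, rfl⟩
    change blk a b ∈ _
    rw [← one_mul b, ← mul_one a, ← blk_mul]
    exact mul_mem (Subgroup.subset_closure (Or.inl (mem_S_zero.2 ⟨_, rfl⟩)))
      (Subgroup.subset_closure (Or.inr (mem_S_one.2 ⟨_, rfl⟩)))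

/-! ### Maps that are multiplicative on `S_{12}`, `Q_{11}` and `Q_{12}` -/

variable (F) in
/-- A map from `Sp_4(F)` to a group that is multiplicative on the block diagonal subgroup and on
the stabilizers of `e_1` and `e_2`. -/
structure PartialHom (K : Type w) [Group K] where
  toFun : Sp F 2 → K
  map_mul_one : ∀ g h, g ∈ fixer (e F 1) → h ∈ fixer (e F 1) → toFun (g * h) = toFun g * toFun h
  map_mul_zero : ∀ g h, g ∈ fixer (e F 0) → h ∈ fixer (e F 0) → toFun (g * h) = toFun g * toFun h
  map_mul_blk : ∀ a b c d, toFun (blk a b * blk c d) = toFun (blk a b) * toFun (blk c d)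

theorem mm_mem_zero (p q r : F) : mm p q r ∈ fixer (e F 0) := (mem_M.1 (mm_mem_M p q r)).1

theorem mm_mem_one (p q r : F) : mm p q r ∈ fixer (e F 1) := (mem_M.1 (mm_mem_M p q r)).2

theorem blk_mem_zero (h : Sp F 1) : blk 1 h ∈ fixer (e F 0) := by
  rw [mem_fixer]; simp [blk_mul_vec]

theorem blk_mem_one (h : Sp F 1) : blk h 1 ∈ fixer (e F 1) := by
  rw [mem_fixer]; simp [blk_mul_vec]

theorem xa_mem (t : F) : xa t ∈ fixer (e F 0) := by
  rw [xa_eq]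
  exact mul_mem (mul_mem (blk_mem_zero _) (mm_mem_zero _ _ _)) (inv_mem (blk_mem_zero _))

theorem xb_mem (t : F) : xb t ∈ fixer (e F 1) := by
  rw [xb_eq]
  exact mul_mem (mul_mem (blk_mem_one _) (mm_mem_one _ _ _)) (inv_mem (blk_mem_one _))

theorem mm_zero : mm (0 : F) 0 0 = 1 := by
  have := mm_mul (0 : F) 0 0 0 0 0
  simpa using this

theorem xa_mul (s t : F) : xa s * xa t = xa (s + t) := by
  rw [xa_eq, xa_eq, xa_eq]
  have := mm_mul 0 s 0 0 t 0
  simp only [add_zero] at this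
  rw [← this]
  group

theorem xb_mul (s t : F) : xb s * xb t = xb (s + t) := by
  rw [xb_eq, xb_eq, xb_eq]
  have := mm_mul 0 s 0 0 t 0
  simp only [add_zero] at this
  rw [← this]
  group

namespace PartialHom

variable {K : Type w} [Group K] (τ : PartialHom F K)

/-- The image of the block diagonal elements. -/
def D (g h : Sp F 1) : K := τ.toFun (blk g h)

/-- The image of the elements that fix `e_1` and `e_2`. -/
def U (p q r : F) : K := τ.toFun (mm p q r)

/-- The image of the root group `xa`. -/
def X (t : F) : K := τ.toFun (xa t)

/-- The image of the root group `xb`. -/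
def Y (t : F) : K := τ.toFun (xb t)

/-! ### Relations between the images of root groups, tori and Weyl elements -/

theorem D_mul (g h g' h' : Sp F 1) : τ.D g h * τ.D g' h' = τ.D (g * g') (h * h') := by
  rw [D, D, D, ← blk_mul, τ.map_mul_blk]

theorem U_mul (p q r p' q' r' : F) :
    τ.U p q r * τ.U p' q' r' = τ.U (p + p') (q + q') (r + r') := by
  rw [U, U, U, ← mm_mul, τ.map_mul_one _ _ (mm_mem_one _ _ _) (mm_mem_one _ _ _)]

theorem map_one : τ.toFun 1 = 1 := by
  have := τ.map_mul_one 1 1 (one_mem _) (one_mem _)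
  rw [mul_one] at this
  exact left_eq_mul.1 this

theorem D_one : τ.D 1 1 = 1 := by rw [D, blk_one, map_one]

theorem U_zero : τ.U 0 0 0 = 1 := by rw [U, mm_zero, map_one]

theorem D_inv (g h : Sp F 1) : (τ.D g h)⁻¹ = τ.D g⁻¹ h⁻¹ := by
  rw [inv_eq_iff_mul_eq_one, D_mul, mul_inv_cancel, mul_inv_cancel, D_one]

theorem D_eq (g h : Sp F 1) : τ.D g h = τ.D g 1 * τ.D 1 h := by simp [D_mul]

theorem D_eq' (g h : Sp F 1) : τ.D g h = τ.D 1 h * τ.D g 1 := by simp [D_mul]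

theorem D_up (p r : F) : τ.D (up p) (up r) = τ.U p 0 r := by rw [D, U, blk_up]

theorem X_mul (s t : F) : τ.X s * τ.X t = τ.X (s + t) := by
  rw [X, X, X, ← xa_mul, τ.map_mul_zero _ _ (xa_mem _) (xa_mem _)]

theorem Y_mul (s t : F) : τ.Y s * τ.Y t = τ.Y (s + t) := by
  rw [Y, Y, Y, ← xb_mul, τ.map_mul_one _ _ (xb_mem _) (xb_mem _)]

theorem X_zero : τ.X 0 = 1 := by simpa using τ.X_mul 0 0

theorem Y_zero : τ.Y 0 = 1 := by simpa using τ.Y_mul 0 0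

theorem dg_one : dg (1 : Fˣ) = 1 := by simp [dg, sl_one]

/-- The torus element is split into its two blocks because each block lies with M_1 in one of the
stabilizers, while the product need not. -/
theorem D_dg_semiconj (a b : Fˣ) (p q r : F) : SemiconjBy (τ.D (dg a) (dg b)) (τ.U p q r)
    (τ.U (a ^ 2 * p) (a * b * q) (b ^ 2 * r)) := by
  rw [D_eq]
  refine SemiconjBy.mul_left (y := τ.U p (b * q) (b ^ 2 * r)) ?_ ?_
  · have := blk_dg_mul_mm a 1 p (b * q) (b ^ 2 * r)
    rw [dg_one] at this
    rw [SemiconjBy, D, U, U, ← τ.map_mul_one _ _ (blk_mem_one _) (mm_mem_one _ _ _), this,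
      τ.map_mul_one _ _ (mm_mem_one _ _ _) (blk_mem_one _)]
    simp [mul_assoc]
  · have := blk_dg_mul_mm 1 b p q r
    rw [dg_one] at this
    rw [SemiconjBy, D, U, U, ← τ.map_mul_zero _ _ (blk_mem_zero _) (mm_mem_zero _ _ _), this,
      τ.map_mul_zero _ _ (mm_mem_zero _ _ _) (blk_mem_zero _)]
    simp

theorem X_semiconj_U (t p q r : F) : SemiconjBy (τ.X t) (τ.U p q r)
    (τ.U (p + 2 * t * q + t ^ 2 * r) (q + t * r) r) := by
  rw [SemiconjBy, X, U, U, ← τ.map_mul_zero _ _ (xa_mem _) (mm_mem_zero _ _ _), xa_mul_mm,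
    τ.map_mul_zero _ _ (mm_mem_zero _ _ _) (xa_mem _)]

theorem Y_semiconj_U (t p q r : F) : SemiconjBy (τ.Y t) (τ.U p q r)
    (τ.U p (q + t * p) (r + 2 * t * q + t ^ 2 * p)) := by
  rw [SemiconjBy, Y, U, U, ← τ.map_mul_one _ _ (xb_mem _) (mm_mem_one _ _ _), xb_mul_mm,
    τ.map_mul_one _ _ (mm_mem_one _ _ _) (xb_mem _)]

theorem D_wy_semiconj_U_right (t : F) : SemiconjBy (τ.D 1 wy) (τ.U 0 t 0) (τ.X t) := by
  rw [SemiconjBy, X, U, D, ← τ.map_mul_zero _ _ (blk_mem_zero _) (mm_mem_zero _ _ _),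
    blk_wy_right_mul, τ.map_mul_zero _ _ (xa_mem _) (blk_mem_zero _)]

theorem D_wy_semiconj_U_left (t : F) : SemiconjBy (τ.D wy 1) (τ.U 0 t 0) (τ.Y t) := by
  rw [SemiconjBy, Y, U, D, ← τ.map_mul_one _ _ (blk_mem_one _) (mm_mem_one _ _ _),
    blk_wy_left_mul, τ.map_mul_one _ _ (xb_mem _) (blk_mem_one _)]

theorem D_wy_semiconj_X (t : F) : SemiconjBy (τ.D 1 wy) (τ.X (-t)) (τ.U 0 t 0) := by
  rw [SemiconjBy, X, U, D, ← τ.map_mul_zero _ _ (mm_mem_zero _ _ _) (blk_mem_zero _),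
    mm_mul_blk_wy_right, τ.map_mul_zero _ _ (blk_mem_zero _) (xa_mem _)]

theorem D_wy_semiconj_Y (t : F) : SemiconjBy (τ.D wy 1) (τ.Y (-t)) (τ.U 0 t 0) := by
  rw [SemiconjBy, Y, U, D, ← τ.map_mul_one _ _ (mm_mem_one _ _ _) (blk_mem_one _),
    mm_mul_blk_wy_left, τ.map_mul_one _ _ (blk_mem_one _) (xb_mem _)]

/-- The conjugation passes through `U 0 t 0`: the first step takes place in the image of `Q11`, the
second in that of `Q12`. -/
theorem D_wy_wy_semiconj_Y (t : F) : SemiconjBy (τ.D wy wy) (τ.Y (-t)) (τ.X t) := by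
  rw [D_eq']
  exact (τ.D_wy_semiconj_U_right t).mul_left (τ.D_wy_semiconj_Y t)

theorem D_wy_wy_semiconj_X (t : F) : SemiconjBy (τ.D wy wy) (τ.X (-t)) (τ.Y t) := by
  rw [D_eq]
  exact (τ.D_wy_semiconj_U_left t).mul_left (τ.D_wy_semiconj_X t)

/-- The conjugates of the elements `U` under the long element of the Weyl group. -/
def L (p q r : F) : K := τ.D wy wy * τ.U (-p) (-q) (-r) * (τ.D wy wy)⁻¹

theorem L_mul (p q r p' q' r' : F) :
    τ.L p q r * τ.L p' q' r' = τ.L (p + p') (q + q') (r + r') := by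
  rw [L, L, L, neg_add, neg_add, neg_add, ← U_mul]
  group

theorem D_wy_wy_semiconj_U (p q r : F) :
    SemiconjBy (τ.D wy wy) (τ.U (-p) (-q) (-r)) (τ.L p q r) := by
  rw [SemiconjBy, L, inv_mul_cancel_right]

theorem D_wy_wy_inv_semiconj_L (p q r : F) :
    SemiconjBy (τ.D wy wy)⁻¹ (τ.L p q r) (τ.U (-p) (-q) (-r)) :=
  (τ.D_wy_wy_semiconj_U p q r).inv_symm_left

/-- Transports a relation known inside one stabilizer to elements that do not lie in a common member
of the amalgam. -/
theorem conj_semiconj {a b c x y : K} (h : SemiconjBy b x y) (h' : SemiconjBy a b c) :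
    SemiconjBy c (a * x * a⁻¹) (a * y * a⁻¹) := by
  have hc : c = a * b * a⁻¹ := by rw [h'.eq, mul_inv_cancel_right]
  have := h.eq
  rw [SemiconjBy, hc]
  calc _ = a * (b * x) * a⁻¹ := by group
    _ = _ := by rw [this]; group

/-- This is the action of `Y` on `U` inside the image of `Q11`, conjugated by the long Weyl element.
-/
theorem X_semiconj_L (t p q r : F) : SemiconjBy (τ.X t) (τ.L p q r)
    (τ.L p (q - t * p) (r - 2 * t * q + t ^ 2 * p)) := by
  have := conj_semiconj (τ.Y_semiconj_U (-t) (-p) (-q) (-r)) (τ.D_wy_wy_semiconj_Y t)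
  rwa [L, L, show -(q - t * p) = -q + -t * -p by ring,
    show -(r - 2 * t * q + t ^ 2 * p) = -r + 2 * -t * -q + (-t) ^ 2 * -p by ring]

theorem Y_semiconj_L (t p q r : F) : SemiconjBy (τ.Y t) (τ.L p q r)
    (τ.L (p - 2 * t * q + t ^ 2 * r) (q - t * r) r) := by
  have := conj_semiconj (τ.X_semiconj_U (-t) (-p) (-q) (-r)) (τ.D_wy_wy_semiconj_X t)
  rwa [L, L, show -(q - t * r) = -q + -t * -r by ring,
    show -(p - 2 * t * q + t ^ 2 * r) = -p + 2 * -t * -q + (-t) ^ 2 * -r by ring]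

/-- Conjugating `up (-t)` by `wy` gives `lo t`, which explains the signs in `L`; the computation
stays in the image of `S12`. -/
theorem D_lo (p r : F) : τ.D (lo p) (lo r) = τ.L p 0 r := by
  rw [L, neg_zero, ← D_up, D_mul, wy_mul_up, wy_mul_up, ← D_mul, mul_inv_cancel_right]

theorem D_dg_semiconj_wy (a b : Fˣ) :
    SemiconjBy (τ.D wy wy) (τ.D (dg a) (dg b))⁻¹ (τ.D (dg a) (dg b)) := by
  rw [SemiconjBy, D_inv, D_mul, D_mul, dg_inv, dg_inv, wy_mul_dg, wy_mul_dg]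

/-- The long Weyl element inverts the torus, so the weights stand on the opposite side from those in
`D_dg_semiconj`. -/
theorem D_dg_semiconj_L (a b : Fˣ) (p q r : F) :
    SemiconjBy (τ.D (dg a) (dg b)) (τ.L (a ^ 2 * p) (a * b * q) (b ^ 2 * r)) (τ.L p q r) := by
  have := conj_semiconj (τ.D_dg_semiconj a b (-p) (-q) (-r)).inv_symm_left
    (τ.D_dg_semiconj_wy a b)
  rwa [L, L, ← mul_neg, ← mul_neg, ← mul_neg]

theorem semiconj_U_congr {x y : K} {p q r p' q' r' : F} (h : SemiconjBy x y (τ.U p q r))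
    (hp : p = p') (hq : q = q') (hr : r = r') : SemiconjBy x y (τ.U p' q' r') := by
  rwa [← hp, ← hq, ← hr]

theorem semiconj_L_congr {x y : K} {p q r p' q' r' : F} (h : SemiconjBy x y (τ.L p q r))
    (hp : p = p') (hq : q = q') (hr : r = r') : SemiconjBy x y (τ.L p' q' r') := by
  rwa [← hp, ← hq, ← hr]

/-- An element that maps `e_2` to `e_1` and `e_1` to `-e_2`. -/
def N : K := τ.Y (-1) * τ.X 1 * τ.Y (-1)

theorem N_semiconj_U (p q r : F) : SemiconjBy τ.N (τ.U p q r) (τ.U r (-q) p) := by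
  exact τ.semiconj_U_congr (((τ.Y_semiconj_U (-1) _ _ _).mul_left (τ.X_semiconj_U 1 _ _ _)).mul_left
    (τ.Y_semiconj_U (-1) p q r)) (by ring) (by ring) (by ring)

theorem N_semiconj_L (p q r : F) : SemiconjBy τ.N (τ.L p q r) (τ.L r (-q) p) := by
  exact τ.semiconj_L_congr (((τ.Y_semiconj_L (-1) _ _ _).mul_left (τ.X_semiconj_L 1 _ _ _)).mul_left
    (τ.Y_semiconj_L (-1) p q r)) (by ring) (by ring) (by ring)

theorem up_zero : up (0 : F) = 1 := sl_one

theorem lo_zero : lo (0 : F) = 1 := sl_one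

/-- The action of `N` on `U` and `L` is known from its factors `X` and `Y`. Diagonal parameters give
the unitriangular elements of both blocks, and these generate. -/
theorem N_semiconj_D (g h : Sp F 1) : SemiconjBy τ.N (τ.D g h) (τ.D h g) := by
  have key : ∀ g, SemiconjBy τ.N (τ.D g 1) (τ.D 1 g) ∧ SemiconjBy τ.N (τ.D 1 g) (τ.D g 1) := by
    intro g
    induction g using sp_one_induction with
    | hup t =>
      rw [← up_zero, D_up, D_up]
      have h1 := τ.N_semiconj_U t 0 0
      have h2 := τ.N_semiconj_U 0 0 t
      rw [neg_zero] at h1 h2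
      exact ⟨h1, h2⟩
    | hlo t =>
      rw [← lo_zero, D_lo, D_lo]
      have h1 := τ.N_semiconj_L t 0 0
      have h2 := τ.N_semiconj_L 0 0 t
      rw [neg_zero] at h1 h2
      exact ⟨h1, h2⟩
    | hmul g h hg hh =>
      have h1 := hg.1.mul_right hh.1
      have h2 := hg.2.mul_right hh.2
      rw [D_mul, D_mul, one_mul] at h1 h2
      exact ⟨h1, h2⟩
  rw [τ.D_eq, τ.D_eq' h g]
  exact (key g).1.mul_right (key h).2

/-- The torus action on `U 0 1 0` is conjugated by `D 1 wy`, which commutes with the first block. -/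
theorem D_dg_semiconj_X (a : Fˣ) : SemiconjBy (τ.D (dg a) 1) (τ.X 1) (τ.X a) := by
  have h1 := τ.D_dg_semiconj a 1 0 1 0
  rw [dg_one] at h1
  have h2 : SemiconjBy (τ.D 1 wy) (τ.D (dg a) 1) (τ.D (dg a) 1) := by simp [SemiconjBy, D_mul]
  have h3 := conj_semiconj h1 h2
  simp only [mul_zero, mul_one, Units.val_one] at h3
  rwa [(τ.D_wy_semiconj_U_right 1).eq, (τ.D_wy_semiconj_U_right a).eq, mul_inv_cancel_right,
    mul_inv_cancel_right] at h3

theorem D_dg_semiconj_Y (a : Fˣ) : SemiconjBy (τ.D 1 (dg a)) (τ.Y 1) (τ.Y a) := by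
  have h1 := τ.D_dg_semiconj 1 a 0 1 0
  rw [dg_one] at h1
  have h2 : SemiconjBy (τ.D wy 1) (τ.D 1 (dg a)) (τ.D 1 (dg a)) := by simp [SemiconjBy, D_mul]
  have h3 := conj_semiconj h1 h2
  simp only [mul_zero, mul_one, one_mul, Units.val_one] at h3
  rwa [(τ.D_wy_semiconj_U_left 1).eq, (τ.D_wy_semiconj_U_left a).eq, mul_inv_cancel_right,
    mul_inv_cancel_right] at h3

/-! ### The three double cosets exhaust the completion -/

/-- The image of the stabilizer of `e_2`. -/
def Q : Subgroup K :=
  (MonoidHom.mk' (fun g : fixer (e F 1) => τ.toFun g.1)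
    (fun g h => τ.map_mul_one _ _ g.2 h.2)).range

theorem mem_Q {g : Sp F 2} (hg : g ∈ fixer (e F 1)) : τ.toFun g ∈ τ.Q := ⟨⟨g, hg⟩, rfl⟩

theorem U_mem_Q (p q r : F) : τ.U p q r ∈ τ.Q := τ.mem_Q (mm_mem_one p q r)

theorem D_mem_Q (g : Sp F 1) : τ.D g 1 ∈ τ.Q := τ.mem_Q (blk_mem_one g)

theorem Y_mem_Q (t : F) : τ.Y t ∈ τ.Q := τ.mem_Q (xb_mem t)

/-- The union of the three double cosets of the block diagonal subgroup and `Q`. -/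
def T : Set K := {k | ∃ g h r q, (r = 1 ∨ r = τ.X 1 ∨ r = τ.N) ∧ q ∈ τ.Q ∧ k = τ.D g h * r * q}

variable {τ}

theorem mul_mem_T {k q : K} (hk : k ∈ τ.T) (hq : q ∈ τ.Q) : k * q ∈ τ.T := by
  obtain ⟨g, h, r, q', hr, hq', rfl⟩ := hk
  exact ⟨g, h, r, q' * q, hr, mul_mem hq' hq, mul_assoc _ _ _⟩

theorem mul_mem_T_iff {k q : K} (hq : q ∈ τ.Q) : k * q ∈ τ.T ↔ k ∈ τ.T :=
  ⟨fun h => by simpa using mul_mem_T h (inv_mem hq), fun h => mul_mem_T h hq⟩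

theorem D_mul_mem_T {k : K} (g h : Sp F 1) (hk : k ∈ τ.T) : τ.D g h * k ∈ τ.T := by
  obtain ⟨g', h', r, q', hr, hq', rfl⟩ := hk
  exact ⟨g * g', h * h', r, q', hr, hq', by rw [← D_mul]; group⟩

variable (τ)

theorem one_mem_T : (1 : K) ∈ τ.T := ⟨1, 1, 1, 1, Or.inl rfl, one_mem _, by simp [D_one]⟩

theorem X_one_mem_T : τ.X 1 ∈ τ.T :=
  ⟨1, 1, _, 1, Or.inr (Or.inl rfl), one_mem _, by simp [D_one]⟩

theorem N_mem_T : τ.N ∈ τ.T := ⟨1, 1, _, 1, Or.inr (Or.inr rfl), one_mem _, by simp [D_one]⟩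

/-- For t ≠ 0 this is a torus conjugate of `X 1`, and the torus element used lies both in the block
diagonal image and in `Q`. -/
theorem X_mem_T (t : F) : τ.X t ∈ τ.T := by
  by_cases ht : t = 0
  · rw [ht, X_zero]; exact τ.one_mem_T
  · have := (τ.D_dg_semiconj_X (Units.mk0 t ht)).eq
    rw [Units.val_mk0] at this
    rw [← mul_mem_T_iff (τ.D_mem_Q (dg (Units.mk0 t ht))), ← this]
    exact D_mul_mem_T _ _ τ.X_one_mem_T

theorem X_one_eq : τ.X 1 = τ.Y 1 * τ.N * τ.Y 1 := by
  simp only [N, mul_assoc, Y_mul]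
  simp [← mul_assoc, Y_mul, Y_zero]

theorem Y_mul_N_mem_T (t : F) : τ.Y t * τ.N ∈ τ.T := by
  by_cases ht : t = 0
  · rw [ht, Y_zero, one_mul]; exact τ.N_mem_T
  · have h1 := (τ.D_dg_semiconj_Y (Units.mk0 t ht)).eq
    have h2 := (τ.N_semiconj_D (dg (Units.mk0 t ht)) 1).eq
    rw [Units.val_mk0] at h1
    rw [← mul_mem_T_iff (τ.D_mem_Q (dg (Units.mk0 t ht))), mul_assoc, h2, ← mul_assoc, ← h1,
      mul_assoc]
    refine D_mul_mem_T _ _ ?_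
    -- After the torus reduces t to 1, `Y 1 * N` lies in the coset of `X 1`.
    rw [← mul_mem_T_iff (τ.Y_mem_Q 1), ← X_one_eq]
    exact τ.X_one_mem_T

theorem map_mem_T {g : Sp F 2} (hg : g ∈ fixer (e F 0)) : τ.toFun g ∈ τ.T := by
  obtain ⟨h, a, p, q, r, rfl⟩ := exists_eq_of_fix_e0 hg
  rw [τ.map_mul_zero _ _ (mul_mem (blk_mem_zero _) (xa_mem _)) (mm_mem_zero _ _ _),
    τ.map_mul_zero _ _ (blk_mem_zero _) (xa_mem _)]
  exact mul_mem_T (D_mul_mem_T _ _ (τ.X_mem_T a)) (τ.U_mem_Q p q r)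

theorem map_mul_N_mem_T {g : Sp F 2} (hg : g ∈ fixer (e F 1)) : τ.toFun g * τ.N ∈ τ.T := by
  obtain ⟨h, a, p, q, r, rfl⟩ := exists_eq_of_fix_e1 hg
  rw [τ.map_mul_one _ _ (mul_mem (blk_mem_one _) (xb_mem _)) (mm_mem_one _ _ _),
    τ.map_mul_one _ _ (blk_mem_one _) (xb_mem _)]
  have := (τ.N_semiconj_U r (-q) p).eq
  rw [neg_neg] at this
  change τ.D h 1 * τ.Y a * τ.U p q r * τ.N ∈ τ.T
  rw [mul_assoc _ (τ.U p q r), ← this, ← mul_assoc]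
  refine mul_mem_T ?_ (τ.U_mem_Q _ _ _)
  rw [mul_assoc]
  exact D_mul_mem_T _ _ (τ.Y_mul_N_mem_T a)

/-- The two blocks are treated by Bruhat decomposition. If one is upper triangular, the product
reduces to `Q12` or to `Q11` times `N`; if both lie in the big cell, the factor `U` is pushed to the
right. -/
theorem U_mul_D_mul_X_mem_T (p q r : F) (g h : Sp F 1) :
    τ.U p q r * (τ.D g h * τ.X 1) ∈ τ.T := by
  by_cases hg : g.1 (.inr 0) (.inl 0) = 0
  · obtain ⟨t, a, rfl⟩ := eq_up_dg g hg
    -- The torus part of g crosses `X 1` into `Q`; everything left over comes from the stabilizer of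
    -- e_1.
    have h1 : τ.D (up t * dg a) h * τ.X 1 =
        τ.D 1 h * τ.U t 0 0 * τ.X a * τ.D (dg a) 1 := by
      rw [mul_assoc _ (τ.X a), ← (τ.D_dg_semiconj_X a).eq, ← mul_assoc, ← D_up, up_zero, D_mul,
        D_mul]
      simp
    have h2 : τ.U p q r * (τ.D 1 h * τ.U t 0 0 * τ.X a) =
        τ.toFun (mm p q r * (blk 1 h * mm t 0 0 * xa (a : F))) := by
      have m1 := blk_mem_zero h
      have m2 := mm_mem_zero t 0 0
      have m3 := xa_mem a.1
      rw [τ.map_mul_zero _ _ (mm_mem_zero _ _ _) (mul_mem (mul_mem m1 m2) m3),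
        τ.map_mul_zero _ _ (mul_mem m1 m2) m3, τ.map_mul_zero _ _ m1 m2]
      rfl
    rw [h1, ← mul_assoc, mul_mem_T_iff (τ.D_mem_Q _), h2]
    exact τ.map_mem_T (mul_mem (mm_mem_zero _ _ _)
      (mul_mem (mul_mem (blk_mem_zero _) (mm_mem_zero _ _ _)) (xa_mem _)))
  by_cases hh : h.1 (.inr 0) (.inl 0) = 0
  · obtain ⟨t, a, rfl⟩ := eq_up_dg h hh
    -- Replacing `X 1` by `Y 1 * N * Y 1` lets the torus part of h cross `N` into the first block,
    -- hence into `Q`. What precedes `N` comes from the stabilizer of e_2.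
    have h1 : τ.D g (up t * dg a) * τ.X 1 =
        τ.D g 1 * τ.U 0 0 t * τ.Y a * τ.N * (τ.D (dg a) 1 * τ.Y 1) := by
      have h3 := (τ.N_semiconj_D (dg a) 1).eq
      calc _ = τ.D g (up t) * (τ.D 1 (dg a) * τ.Y 1) * τ.N * τ.Y 1 := by
            rw [X_one_eq, ← mul_one g, ← D_mul]
            simp only [mul_assoc, mul_one]
        _ = τ.D g (up t) * τ.Y a * (τ.D 1 (dg a) * τ.N) * τ.Y 1 := by
            rw [(τ.D_dg_semiconj_Y a).eq]; simp only [mul_assoc]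
        _ = _ := by
            rw [← h3, ← D_up, up_zero, D_mul]; simp [mul_assoc]
    have h2 : τ.U p q r * (τ.D g 1 * τ.U 0 0 t * τ.Y a) =
        τ.toFun (mm p q r * (blk g 1 * mm 0 0 t * xb (a : F))) := by
      have m1 := blk_mem_one g
      have m2 := mm_mem_one 0 0 t
      have m3 := xb_mem a.1
      rw [τ.map_mul_one _ _ (mm_mem_one _ _ _) (mul_mem (mul_mem m1 m2) m3),
        τ.map_mul_one _ _ (mul_mem m1 m2) m3, τ.map_mul_one _ _ m1 m2]
      rfl
    rw [h1, ← mul_assoc, mul_mem_T_iff (mul_mem (τ.D_mem_Q _) (τ.Y_mem_Q 1)), ← mul_assoc, h2]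
    exact τ.map_mul_N_mem_T (mul_mem (mm_mem_one _ _ _)
      (mul_mem (mul_mem (blk_mem_one _) (mm_mem_one _ _ _)) (xb_mem _)))
  obtain ⟨p1, a, t1, rfl⟩ : ∃ p a t, g = up p * wy⁻¹ * dg a * up t :=
    ⟨_, _, _, eq_up_wy_dg_up g (Units.mk0 _ hg) rfl⟩
  obtain ⟨p2, b, t2, rfl⟩ : ∃ p a t, h = up p * wy⁻¹ * dg a * up t :=
    ⟨_, _, _, eq_up_wy_dg_up h (Units.mk0 _ hh) rfl⟩
  rw [← D_mul, D_up, mul_assoc]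
  -- `X 1` normalizes the image of M_1, so the rightmost unipotent factors disappear into `Q`.
  have hX : ∃ p q r, τ.U t1 0 t2 * τ.X 1 = τ.X 1 * τ.U p q r := by
    refine ⟨t1 + t2, -t2, t2, (τ.semiconj_U_congr (τ.X_semiconj_U 1 _ _ _) ?_ ?_ ?_).eq.symm⟩ <;>
      ring
  obtain ⟨p', q', r', hX⟩ := hX
  rw [hX, ← mul_assoc, ← mul_assoc, mul_mem_T_iff (τ.U_mem_Q _ _ _), ← D_mul, ← D_mul, D_up,
    ← D_inv, ← mul_assoc, ← mul_assoc, U_mul, add_comm p, add_comm q, add_comm r, ← U_mul]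
  have h1 := (τ.D_wy_wy_inv_semiconj_L (-p) (-q) (-r)).eq
  simp only [neg_neg] at h1
  have h2 := (τ.D_dg_semiconj_L a b (-p) (-q) (-r)).eq
  set p3 := (a : F) ^ 2 * -p
  set q3 := (a : F) * b * -q
  set r3 := (b : F) ^ 2 * -r
  -- Diagonal plus rank one: the second factor is chosen with off-diagonal entry q3 so that crossing
  -- `X 1` turns it into a diagonal matrix.
  have h3 : τ.L p3 q3 r3 = τ.D (lo (p3 + q3)) (lo (r3 + q3)) * τ.L (-q3) q3 (-q3) := by
    rw [D_lo, L_mul]; congr 1 <;> ring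
  have h4 : τ.L (-q3) q3 (-q3) * τ.X 1 = τ.X 1 * τ.D (lo (-q3)) 1 := by
    rw [← lo_zero, D_lo, (τ.X_semiconj_L 1 (-q3) 0 0).eq]
    congr 2 <;> ring
  have h5 : τ.U p1 0 p2 * τ.U p q r * (τ.D wy wy)⁻¹ * τ.D (dg a) (dg b) * τ.X 1 =
      τ.U p1 0 p2 * ((τ.D wy wy)⁻¹ * (τ.D (dg a) (dg b) *
        (τ.D (lo (p3 + q3)) (lo (r3 + q3)) * τ.X 1))) * τ.D (lo (-q3)) 1 := by
    calc _ = τ.U p1 0 p2 * (τ.U p q r * (τ.D wy wy)⁻¹) * τ.D (dg a) (dg b) * τ.X 1 := by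
          simp only [mul_assoc]
      _ = τ.U p1 0 p2 * (τ.D wy wy)⁻¹ * (τ.L (-p) (-q) (-r) * τ.D (dg a) (dg b)) * τ.X 1 := by
          rw [← h1]; simp only [mul_assoc]
      _ = τ.U p1 0 p2 * (τ.D wy wy)⁻¹ * τ.D (dg a) (dg b) * τ.D (lo (p3 + q3)) (lo (r3 + q3)) *
          (τ.L (-q3) q3 (-q3) * τ.X 1) := by
          rw [← h2, h3]; simp only [mul_assoc]
      _ = _ := by rw [h4]; simp only [mul_assoc]
  rw [h5, mul_mem_T_iff (τ.D_mem_Q _), ← D_up, D_inv]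
  exact D_mul_mem_T _ _ (D_mul_mem_T _ _ (D_mul_mem_T _ _ (D_mul_mem_T _ _ τ.X_one_mem_T)))

/-- For the representatives 1 and `N`, one block moves to the right into `Q`; the other combines
with `U` in a single stabilizer. -/
theorem U_mul_mem_T {k : K} (p q r : F) (hk : k ∈ τ.T) : τ.U p q r * k ∈ τ.T := by
  obtain ⟨g, h, s, x, hs, hx, rfl⟩ := hk
  rw [← mul_assoc, mul_mem_T_iff hx]
  rcases hs with rfl | rfl | rfl
  · have h2 : τ.U p q r * τ.D 1 h = τ.toFun (mm p q r * blk 1 h) :=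
      (τ.map_mul_zero _ _ (mm_mem_zero _ _ _) (blk_mem_zero _)).symm
    rw [mul_one, D_eq', ← mul_assoc, mul_mem_T_iff (τ.D_mem_Q _), h2]
    exact τ.map_mem_T (mul_mem (mm_mem_zero _ _ _) (blk_mem_zero _))
  · exact τ.U_mul_D_mul_X_mem_T p q r g h
  · have h2 : τ.U p q r * τ.D g 1 = τ.toFun (mm p q r * blk g 1) :=
      (τ.map_mul_one _ _ (mm_mem_one _ _ _) (blk_mem_one _)).symm
    rw [D_eq, mul_assoc, ← (τ.N_semiconj_D h 1).eq, ← mul_assoc, ← mul_assoc,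
      mul_mem_T_iff (τ.D_mem_Q _), h2]
    exact τ.map_mul_N_mem_T (mul_mem (mm_mem_one _ _ _) (blk_mem_one _))

/-- If `K` is generated by the images of the block diagonal elements and of the elements that fix
`e_1` and `e_2`, then it is the union of three double cosets. -/
theorem T_eq_univ (hτ : ∀ H : Subgroup K, (∀ g h, τ.D g h ∈ H) → (∀ p q r, τ.U p q r ∈ H) → H = ⊤)
    (k : K) : k ∈ τ.T := by
  let H : Subgroup K :=
    -- The equivalence, rather than one implication, gives closure under inverses.
    { carrier := {x | ∀ k, x * k ∈ τ.T ↔ k ∈ τ.T}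
      one_mem' := fun k => by rw [one_mul]
      mul_mem' := fun {x y} hx hy k => by rw [mul_assoc, hx, hy]
      inv_mem' := fun {x} hx k => by rw [← hx, mul_inv_cancel_left] }
  have hH : H = ⊤ := by
    apply hτ
    · refine fun g h k => ⟨fun hk => ?_, D_mul_mem_T g h⟩
      rw [← inv_mul_cancel_left (τ.D g h) k, D_inv]
      exact D_mul_mem_T _ _ hk
    · refine fun p q r k => ⟨fun hk => ?_, τ.U_mul_mem_T p q r⟩
      have := τ.U_mul_mem_T (-p) (-q) (-r) hk
      rwa [← mul_assoc, U_mul, neg_add_cancel, neg_add_cancel, neg_add_cancel, U_zero,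
        one_mul] at this
  have hk : k ∈ H := hH ▸ Subgroup.mem_top k
  simpa using (hk 1).2 τ.one_mem_T

/-! ### Separating the double cosets by their action on e_2, and generation of Sp_4 -/

theorem xa_mulVec (t : F) : (xa t).1 *ᵥ e F 1 = e F 1 + t • e F 0 := by
  ext (i | i) <;> fin_cases i <;> simp [xa, e]

theorem xb_xa_xb_mulVec : (xb (-1 : F) * xa 1 * xb (-1)).1 *ᵥ e F 1 = e F 0 := by
  have h : (xb (-1 : F)).1 *ᵥ e F 0 = e F 0 - e F 1 := by
    ext (i | i) <;> fin_cases i <;> simp [xb, e]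
  rw [mul_mulVec, mul_mulVec, xb_mem, xa_mulVec, mulVec_add, xb_mem, one_smul, h]
  abel

/-- The component in ⟨e_1, f_1⟩ of the image is the nonzero first column of g. The values c = 1 and
c = 0 exclude the representatives `X 1` and `N`. -/
theorem blk_mulVec_e_zero_ne (g h : Sp F 1) {c : F} :
    (blk g h).1 *ᵥ (c • e F 1 + e F 0) ≠ e F 1 := by
  intro H
  rw [mulVec_add, mulVec_smul, (blk_mul_vec g h).1, (blk_mul_vec g h).2.2.1] at H
  have h1 := congrFun H (.inl 0)
  have h2 := congrFun H (.inr 0)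
  have h3 := sp_one_det g
  simp [e, f] at h1 h2
  simp [h1, h2] at h3

/-- A homomorphism `K → Sp_4(F)` that `τ` is a partial section of is injective. -/
theorem injective_of_leftInverse
    (hτ : ∀ H : Subgroup K, (∀ g h, τ.D g h ∈ H) → (∀ p q r, τ.U p q r ∈ H) → H = ⊤)
    (π : K →* Sp F 2) (hD : ∀ g h, π (τ.D g h) = blk g h)
    (h1 : ∀ g ∈ fixer (e F 1), π (τ.toFun g) = g) (h0 : ∀ g ∈ fixer (e F 0), π (τ.toFun g) = g) :
    Function.Injective π := by
  rw [injective_iff_map_eq_one]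
  intro k hk
  obtain ⟨g, h, r, _, hr, ⟨⟨q, hq⟩, rfl⟩, rfl⟩ := τ.T_eq_univ hτ k
  change π (τ.D g h * r * τ.toFun q) = 1 at hk
  rw [map_mul, map_mul, h1 q hq, hD] at hk
  have key : (blk g h * π r).1 *ᵥ e F 1 = e F 1 := by
    have h3 := (one_mulVec' (e F 1))
    rwa [← hk, mul_mulVec, hq] at h3
  rw [mul_mulVec] at key
  rcases hr with rfl | rfl | rfl
  · rw [_root_.map_one, one_mulVec'] at key
    rw [_root_.map_one, mul_one] at hk
    change τ.D g h * 1 * τ.toFun q = 1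
    -- Now `blk g h` also fixes e_2, so the product can be formed in the stabilizer before applying
    -- `τ`.
    rw [mul_one, D, ← τ.map_mul_one _ _ key hq, hk, τ.map_one]
  · exfalso
    rw [X, h0 _ (xa_mem 1), xa_mulVec, one_smul] at key
    exact blk_mulVec_e_zero_ne g h (c := 1) (by rwa [one_smul])
  · exfalso
    rw [N, map_mul, map_mul, X, Y, h0 _ (xa_mem 1), h1 _ (xb_mem _), xb_xa_xb_mulVec] at key
    exact blk_mulVec_e_zero_ne g h (c := 0) (by rwa [zero_smul, zero_add])

end PartialHom

/-- `Sp_4(F)` is generated by the block diagonal elements and the stabilizers of `e_1`, `e_2`. -/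
theorem eq_top_of_blk_mem {H : Subgroup (Sp F 2)} (hb : ∀ g h, blk g h ∈ H)
    (h0 : fixer (e F 0) ≤ H) (h1 : fixer (e F 1) ≤ H) : H = ⊤ := by
  rw [Subgroup.eq_top_iff']
  intro g
  -- As H contains the stabilizer of e_2, only the image of e_2 matters; the cases are the three
  -- orbits of the block diagonal group.
  suffices h : ∃ k ∈ H, g.1 *ᵥ e F 1 = k.1 *ᵥ e F 1 by
    obtain ⟨k, hk, hgk⟩ := h
    rw [← mul_inv_cancel_left k g]
    exact mul_mem hk (h1 ((inv_mul_mulVec_eq_iff k g _).2 hgk))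
  have hN : xb (-1 : F) * xa 1 * xb (-1) ∈ H :=
    mul_mem (mul_mem (h1 (xb_mem _)) (h0 (xa_mem _))) (h1 (xb_mem _))
  by_cases hu : g.1 (.inl 0) (.inl 1) ≠ 0 ∨ g.1 (.inr 0) (.inl 1) ≠ 0
  · obtain ⟨a, ha, ha'⟩ := exists_col _ _ hu
    by_cases hv : g.1 (.inl 1) (.inl 1) ≠ 0 ∨ g.1 (.inr 1) (.inl 1) ≠ 0
    · obtain ⟨b, hb1, hb2⟩ := exists_col _ _ hv
      refine ⟨blk a b * xa 1, mul_mem (hb _ _) (h0 (xa_mem _)), ?_⟩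
      rw [mul_mulVec, PartialHom.xa_mulVec, one_smul, mulVec_add, (blk_mul_vec a b).1,
        (blk_mul_vec a b).2.2.1, ha, ha', hb1, hb2, mulVec_e]
      ext (i | i) <;> fin_cases i <;> simp [e, f]
    · push Not at hv
      refine ⟨blk a 1 * (xb (-1 : F) * xa 1 * xb (-1)), mul_mem (hb _ _) hN, ?_⟩
      rw [mul_mulVec, PartialHom.xb_xa_xb_mulVec, (blk_mul_vec a 1).1, ha, ha', mulVec_e]
      ext (i | i) <;> fin_cases i <;> simp [e, f, hv]
  · push Not at hu
    obtain ⟨b, hb1, hb2⟩ := exists_col (g.1 (.inl 1) (.inl 1)) (g.1 (.inr 1) (.inl 1)) (by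
      by_contra! hv
      have := form_col g (.inl 1) (.inr 1)
      simp [hu, hv, form] at this)
    refine ⟨blk 1 b, hb _ _, ?_⟩
    rw [(blk_mul_vec 1 b).2.2.1, hb1, hb2, mulVec_e]
    ext (i | i) <;> fin_cases i <;> simp [e, f, hu]

/-! ### The isomorphism types of `S_{12}`, `Q_{11}` and `Q_{12}` -/

theorem emb_injective : Function.Injective (emb (F := F)) := by
  rintro ⟨a, b⟩ ⟨c, d⟩ h
  have key : ∀ i j, (blk a b).1 i j = (blk c d).1 i j := fun i j => by
    have := congrArg (fun g : Sp F 2 => g.1 i j) h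
    exact this
  refine Prod.ext (sp_one_ext ?_ ?_ ?_ ?_) (sp_one_ext ?_ ?_ ?_ ?_)
  · simpa [blk] using key (.inl 0) (.inl 0)
  · simpa [blk] using key (.inl 0) (.inr 0)
  · simpa [blk] using key (.inr 0) (.inl 0)
  · simpa [blk] using key (.inr 0) (.inr 0)
  · simpa [blk] using key (.inl 1) (.inl 1)
  · simpa [blk] using key (.inl 1) (.inr 1)
  · simpa [blk] using key (.inr 1) (.inl 1)
  · simpa [blk] using key (.inr 1) (.inr 1)

variable (F) in
theorem nonempty_S12_equiv : Nonempty (S12 F ≃* Sp F 1 × Sp F 1) := by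
  rw [S12_eq_range]
  exact ⟨(MonoidHom.ofInjective emb_injective).symm⟩

theorem map_conj_fixer (g : Sp F 2) (x : Fin 2 ⊕ Fin 2 → F) :
    (fixer x).map (MulAut.conj g).toMonoidHom = fixer (g.1 *ᵥ x) := by
  ext k
  constructor
  · rintro ⟨h, hh, rfl⟩
    change (g * h * g⁻¹).1 *ᵥ _ = _
    rw [← mul_mulVec, inv_mul_cancel_right, mul_mulVec, mem_fixer.1 hh]
  · intro hk
    refine ⟨g⁻¹ * k * g, ?_, ?_⟩
    · change (g⁻¹ * k * g).1 *ᵥ _ = _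
      rw [mul_assoc, inv_mul_mulVec_eq_iff, mul_mulVec, hk]
    · change g * (g⁻¹ * k * g) * g⁻¹ = k
      group

variable (F) in
-- The two groups stabilize e_2 and e_1, so an element moving e_2 to e_1 conjugates one to the
-- other.
theorem nonempty_Q11_equiv_Q12 : Nonempty (Q11 F ≃* Q12 F) := by
  rw [Q11_eq_fixer, Q12_eq_fixer, ← PartialHom.xb_xa_xb_mulVec, ← map_conj_fixer]
  exact ⟨Subgroup.equivMapOfInjective _ _ (MulAut.conj _).injective⟩

/-- The element of the stabilizer of `e_2` with given parameters. -/
def par (x y b : F) (g : Sp F 1) : Sp F 2 :=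
  ⟨fromBlocks
      !![g.1 (.inl 0) (.inl 0), 0;
        x * g.1 (.inr 0) (.inl 0) - y * g.1 (.inl 0) (.inl 0), 1]
      !![g.1 (.inl 0) (.inr 0), x;
        x * g.1 (.inr 0) (.inr 0) - y * g.1 (.inl 0) (.inr 0), b]
      !![g.1 (.inr 0) (.inl 0), 0; 0, 0]
      !![g.1 (.inr 0) (.inr 0), y; 0, 1], by
    have h := sp_one_det g
    rw [SymplecticGroup.mem_iff, J, fromBlocks_transpose, fromBlocks_multiply, fromBlocks_multiply]
    ext (i | i) (j | j) <;> fin_cases i <;> fin_cases j <;>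
      simp [Matrix.vecMul, dotProduct] <;>
      first | ring1 | linear_combination h | linear_combination -h | linear_combination x * h |
        linear_combination -x * h | linear_combination y * h | linear_combination -y * h⟩

/-- The parameters x, y, b are coordinates of the image of f_2. Composing adds the form of (x, y)
and g (x', y') to b + b', which is the cocycle of `Heis` twisted by the action. -/
theorem par_mul (x y b x' y' b' : F) (g g' : Sp F 1) :
    par x y b g * par x' y' b' g' =
      par (x + (g.1 (.inl 0) (.inl 0) * x' + g.1 (.inl 0) (.inr 0) * y'))
        (y + (g.1 (.inr 0) (.inl 0) * x' + g.1 (.inr 0) (.inr 0) * y'))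
        (b + b' + (x * (g.1 (.inr 0) (.inl 0) * x' + g.1 (.inr 0) (.inr 0) * y') -
          y * (g.1 (.inl 0) (.inl 0) * x' + g.1 (.inl 0) (.inr 0) * y'))) (g * g') := by
  have h := sp_one_det g
  apply Subtype.ext
  simp only [par, sp_one_mul_apply, Submonoid.mk_mul_mk, fromBlocks_multiply]
  congr 1 <;> ext i j <;> fin_cases i <;> fin_cases j <;> simp
  · linear_combination (y' * g'.1 (.inl 0) (.inl 0) - x' * g'.1 (.inr 0) (.inl 0)) * h
  · ring
  · linear_combination (y' * g'.1 (.inl 0) (.inr 0) - x' * g'.1 (.inr 0) (.inr 0)) * h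
  · ring
  · ring

theorem par_zero : par 0 0 0 (1 : Sp F 1) = 1 := by
  apply Subtype.ext
  ext (i | i) (j | j) <;> fin_cases i <;> fin_cases j <;> simp [par]

/-- The embedding of `V ⋊ Sp_2(F)` as the stabilizer of `e_2`. -/
def parHom : Heis F ⋊[Heis.act] Sp F 1 →* Sp F 2 where
  toFun p := par (p.left.vec (.inl 0)) (p.left.vec (.inr 0)) p.left.z p.right
  map_one' := par_zero
  map_mul' p q := by
    rw [par_mul]
    change par ((p * q).left.vec (.inl 0)) ((p * q).left.vec (.inr 0)) (p * q).left.z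
      (p.right * q.right) = _
    rw [SemidirectProduct.mul_left]
    congr 1 <;> simp [Heis.act, form, mulVec, dotProduct]

theorem parHom_injective : Function.Injective (parHom (F := F)) := by
  intro p q h
  have key : ∀ i j, (par (p.left.vec (.inl 0)) (p.left.vec (.inr 0)) p.left.z p.right).1 i j =
      (par (q.left.vec (.inl 0)) (q.left.vec (.inr 0)) q.left.z q.right).1 i j := fun i j => by
    have := congrArg (fun g : Sp F 2 => g.1 i j) h
    exact this
  refine SemidirectProduct.ext (Heis.ext (funext ?_) ?_) (sp_one_ext ?_ ?_ ?_ ?_)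
  · rintro (i | i) <;> fin_cases i
    · simpa [par] using key (.inl 0) (.inr 1)
    · simpa [par] using key (.inr 0) (.inr 1)
  · simpa [par] using key (.inl 1) (.inr 1)
  · simpa [par] using key (.inl 0) (.inl 0)
  · simpa [par] using key (.inl 0) (.inr 0)
  · simpa [par] using key (.inr 0) (.inl 0)
  · simpa [par] using key (.inr 0) (.inr 0)

theorem blk_eq_par (g : Sp F 1) : blk g 1 = par 0 0 0 g := by
  apply Subtype.ext
  ext (i | i) (j | j) <;> fin_cases i <;> fin_cases j <;> simp [par, blk]

theorem xb_eq_par (t : F) : xb t = par 0 (-t) 0 1 := by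
  apply Subtype.ext
  ext (i | i) (j | j) <;> fin_cases i <;> fin_cases j <;> simp [par, xb]

theorem mm_eq_par (p q r : F) : mm p q r = par q 0 r (up p) := by
  apply Subtype.ext
  ext (i | i) (j | j) <;> fin_cases i <;> fin_cases j <;> simp [par, mm, up, sl]

theorem par_mem_range (x y b : F) (g : Sp F 1) : par x y b g ∈ (parHom (F := F)).range :=
  ⟨⟨⟨Sum.elim (fun _ => x) (fun _ => y), b⟩, g⟩, rfl⟩

theorem Q11_eq_range : Q11 F = (parHom (F := F)).range := by
  rw [Q11_eq_fixer]
  apply le_antisymm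
  · intro g hg
    obtain ⟨h, a, p, q, r, rfl⟩ := exists_eq_of_fix_e1 hg
    rw [blk_eq_par, xb_eq_par, mm_eq_par]
    exact mul_mem (mul_mem (par_mem_range _ _ _ _) (par_mem_range _ _ _ _)) (par_mem_range _ _ _ _)
  · rintro _ ⟨p, rfl⟩
    change (par _ _ _ _).1 *ᵥ _ = _
    rw [mulVec_e]
    ext (i | i) <;> fin_cases i <;> simp [par, e]

variable (F) in
theorem nonempty_Q11_equiv_semidirect :
    Nonempty (Q11 F ≃* Heis F ⋊[Heis.act] Sp F 1) := by
  rw [Q11_eq_range]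
  exact ⟨(MonoidHom.ofInjective parHom_injective).symm⟩

/-- In characteristic two, the cocycle of `V` is the coboundary of `(x_1, x_2) ↦ x_1 x_2`. -/
theorem nonempty_heis_equiv (h : ringChar F = 2) :
    Nonempty (Heis F ≃* Multiplicative (Fin 3 → F)) := by
  have h2 : (2 : F) = 0 := by
    have := ringChar.Nat.cast_ringChar (R := F)
    rw [h] at this
    exact_mod_cast this
  refine ⟨⟨⟨fun x => Multiplicative.ofAdd ![x.vec (.inl 0), x.vec (.inr 0),
      x.z + x.vec (.inl 0) * x.vec (.inr 0)],
    fun y => ⟨Sum.elim (fun _ => y.toAdd 0) (fun _ => y.toAdd 1),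
      y.toAdd 2 - y.toAdd 0 * y.toAdd 1⟩, fun x => ?_, fun y => ?_⟩, fun x y => ?_⟩⟩
  · refine Heis.ext (funext ?_) ?_
    · rintro (i | i) <;> fin_cases i <;> simp
    · simp
  · apply Multiplicative.toAdd.injective
    ext i
    fin_cases i <;> simp
  · apply Multiplicative.toAdd.injective
    ext i
    fin_cases i <;> simp [form]
    linear_combination (x.vec (.inl 0) * y.vec (.inr 0)) * h2

end Symp

/-! ### The universal completion -/

namespace Amalgam

variable {B : Type v} [PartialOrder B] (A : Amalgam.{v, w} B)

/-- The canonical homomorphisms from the groups of an amalgam to its universal completion. -/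
def ι (β : B) : A.grp β →* A.Completion :=
  MonoidHom.mk' (fun a => PresentedGroup.of ⟨β, a⟩) fun a b => by
    symm
    rw [← mul_inv_eq_one]
    exact PresentedGroup.one_of_mem (Rel.mul β a b)

theorem ι_map {β γ : B} (h : β < γ) (a : A.grp β) : A.ι γ (A.map h a) = A.ι β a := by
  symm
  rw [← mul_inv_eq_one]
  exact PresentedGroup.one_of_mem (Rel.glue h a)

theorem lift_ι {K : Type u} [Group K] (ψ : ∀ β, A.grp β →* K)
    (hψ : ∀ {β γ : B} (h : β < γ) (a : A.grp β), ψ γ (A.map h a) = ψ β a) (β : B) (a : A.grp β) :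
    A.lift ψ hψ (A.ι β a) = ψ β a :=
  PresentedGroup.toGroup.of _

theorem eq_top_of_ι_mem {H : Subgroup A.Completion} (h : ∀ β a, A.ι β a ∈ H) : H = ⊤ := by
  rw [eq_top_iff, ← PresentedGroup.closure_range_of, Subgroup.closure_le]
  rintro _ ⟨⟨β, a⟩, rfl⟩
  exact h β a

end Amalgam

/-! ### Gluing the maps of the amalgam into its completion -/

namespace Symp

variable (F : Type u) [Field F]

/-- The amalgam of the six subgroups. -/
abbrev amalgam : Amalgam Node := Amalgam.ofSubgroups (slim F) (slim_monotone F)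

variable {F}

open scoped Classical in
/-- The canonical map from a member of the amalgam to the completion, extended by `1`. -/
noncomputable def inc (β : Node) (g : Sp F 2) : (amalgam F).Completion :=
  if h : g ∈ slim F β then (amalgam F).ι β ⟨g, h⟩ else 1

theorem inc_eq {β : Node} {g : Sp F 2} (h : g ∈ slim F β) :
    inc β g = (amalgam F).ι β ⟨g, h⟩ := dif_pos h

theorem inc_mul {β : Node} {g h : Sp F 2} (hg : g ∈ slim F β) (hh : h ∈ slim F β) :
    inc β (g * h) = inc β g * inc β h := by
  rw [inc_eq hg, inc_eq hh, inc_eq (mul_mem hg hh)]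
  exact ((amalgam F).ι β).map_mul ⟨g, hg⟩ ⟨h, hh⟩

theorem inc_of_lt {β γ : Node} (h : β.gens ⊂ γ.gens) {g : Sp F 2} (hβ : g ∈ slim F β) :
    inc γ g = inc β g := by
  have h' : β < γ := h
  rw [inc_eq hβ, inc_eq (slim_monotone F h'.le hβ)]
  exact (amalgam F).ι_map h' ⟨g, hβ⟩

open scoped Classical in
/-- The common extension of the maps from `S_{12}`, `Q_{11}` and `Q_{12}` to the completion. -/
noncomputable def toCompletion (g : Sp F 2) : (amalgam F).Completion :=
  if g ∈ Q11 F then inc .Q11 g else if g ∈ Q12 F then inc .Q12 g else inc .S12 g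

theorem toCompletion_Q11 {g : Sp F 2} (h : g ∈ Q11 F) : toCompletion g = inc .Q11 g := if_pos h

/-- The two stabilizers meet exactly in M_1, a member of the amalgam, so the gluing relations make
the definitions agree. -/
theorem toCompletion_Q12 {g : Sp F 2} (h : g ∈ Q12 F) : toCompletion g = inc .Q12 g := by
  by_cases h' : g ∈ Q11 F
  · have hM : g ∈ slim F .M1 := by
      rw [Q11_eq_fixer] at h'
      rw [Q12_eq_fixer] at h
      exact mem_M.2 ⟨h, h'⟩
    rw [toCompletion_Q11 h', inc_of_lt (β := .M1) (γ := .Q11) (by decide) hM,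
      inc_of_lt (β := .M1) (γ := .Q12) (by decide) hM]
  · rw [toCompletion, if_neg h', if_pos h]

theorem blk_mem_S12 (a b : Sp F 1) : blk a b ∈ slim F .S12 := by
  change blk a b ∈ S12 F
  rw [S12_eq_range]
  exact ⟨(a, b), rfl⟩

theorem inc_S12_left (a : Sp F 1) : inc .S12 (blk a 1) = toCompletion (blk a 1) := by
  have h : blk a 1 ∈ slim F .S1 := mem_S_zero.2 ⟨a, rfl⟩
  rw [toCompletion_Q11 (Subgroup.subset_closure (Or.inr h)),
    inc_of_lt (β := .S1) (γ := .Q11) (by decide) h, inc_of_lt (β := .S1) (γ := .S12) (by decide) h]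

theorem inc_S12_right (a : Sp F 1) : inc .S12 (blk 1 a) = toCompletion (blk 1 a) := by
  have h : blk 1 a ∈ slim F .S2 := mem_S_one.2 ⟨a, rfl⟩
  rw [toCompletion_Q12 (Subgroup.subset_closure (Or.inr h)),
    inc_of_lt (β := .S2) (γ := .Q12) (by decide) h, inc_of_lt (β := .S2) (γ := .S12) (by decide) h]

theorem blk_eq_mul (a b : Sp F 1) : blk a b = blk a 1 * blk 1 b := by
  rw [blk_mul, mul_one, one_mul]

theorem toCompletion_mul_one (g h : Sp F 2) (hg : g ∈ fixer (e F 1)) (hh : h ∈ fixer (e F 1)) :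
    toCompletion (g * h) = toCompletion g * toCompletion h := by
  rw [← Q11_eq_fixer] at hg hh
  rw [toCompletion_Q11 hg, toCompletion_Q11 hh, toCompletion_Q11 (mul_mem hg hh), inc_mul hg hh]

theorem toCompletion_mul_zero (g h : Sp F 2) (hg : g ∈ fixer (e F 0)) (hh : h ∈ fixer (e F 0)) :
    toCompletion (g * h) = toCompletion g * toCompletion h := by
  rw [← Q12_eq_fixer] at hg hh
  rw [toCompletion_Q12 hg, toCompletion_Q12 hh, toCompletion_Q12 (mul_mem hg hh), inc_mul hg hh]

/-- If `blk a b` fixes e_2 or e_1, then so do both factors `blk a 1` and `blk 1 b`. The overlap thus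
reduces to S_1 and S_2, where the gluing relations apply. -/
theorem toCompletion_blk (a b : Sp F 1) : toCompletion (blk a b) = inc .S12 (blk a b) := by
  have hab : inc .S12 (blk a b) = toCompletion (blk a 1) * toCompletion (blk 1 b) := by
    rw [blk_eq_mul, inc_mul (blk_mem_S12 _ _) (blk_mem_S12 _ _), inc_S12_left, inc_S12_right]
  by_cases h1 : blk a b ∈ fixer (e F 1)
  · have hb : blk 1 b ∈ fixer (e F 1) := by
      rw [mem_fixer] at h1 ⊢
      rwa [(blk_mul_vec 1 b).2.2.1, ← (blk_mul_vec a b).2.2.1]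
    rw [hab, blk_eq_mul, toCompletion_mul_one _ _ (blk_mem_one a) hb]
  by_cases h0 : blk a b ∈ fixer (e F 0)
  · have ha : blk a 1 ∈ fixer (e F 0) := by
      rw [mem_fixer] at h0 ⊢
      rwa [(blk_mul_vec a 1).1, ← (blk_mul_vec a b).1]
    rw [hab, blk_eq_mul, toCompletion_mul_zero _ _ ha (blk_mem_zero b)]
  · rw [← Q11_eq_fixer] at h1
    rw [← Q12_eq_fixer] at h0
    rw [toCompletion, if_neg h1, if_neg h0]

variable (F) in
/-- The common extension as a partial homomorphism. -/
noncomputable def partialHom : PartialHom F (amalgam F).Completion where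
  toFun := toCompletion
  map_mul_one := toCompletion_mul_one
  map_mul_zero := toCompletion_mul_zero
  map_mul_blk a b c d := by
    rw [toCompletion_blk, toCompletion_blk, ← inc_mul (blk_mem_S12 a b) (blk_mem_S12 c d), blk_mul,
      toCompletion_blk]

/-- The root groups `X` and `Y` are conjugates of `U` by block diagonal elements, so H contains the
images of both stabilizers. -/
theorem eq_top_of_mem {H : Subgroup (amalgam F).Completion}
    (hD : ∀ g h, (partialHom F).D g h ∈ H) (hU : ∀ p q r, (partialHom F).U p q r ∈ H) :
    H = ⊤ := by
  have h0 : ∀ g ∈ fixer (e F 0), toCompletion g ∈ H := by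
    intro g hg
    obtain ⟨h, a, p, q, r, rfl⟩ := exists_eq_of_fix_e0 hg
    have hx : toCompletion (xa a) ∈ H := by
      have h := eq_mul_inv_of_mul_eq ((partialHom F).D_wy_semiconj_U_right a).eq.symm
      change (partialHom F).X a ∈ H
      rw [h]
      exact mul_mem (mul_mem (hD _ _) (hU _ _ _)) (inv_mem (hD _ _))
    rw [toCompletion_mul_zero _ _ (mul_mem (blk_mem_zero _) (xa_mem _)) (mm_mem_zero _ _ _),
      toCompletion_mul_zero _ _ (blk_mem_zero _) (xa_mem _)]
    exact mul_mem (mul_mem (hD _ _) hx) (hU _ _ _)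
  have h1 : ∀ g ∈ fixer (e F 1), toCompletion g ∈ H := by
    intro g hg
    obtain ⟨h, a, p, q, r, rfl⟩ := exists_eq_of_fix_e1 hg
    have hx : toCompletion (xb a) ∈ H := by
      have h := eq_mul_inv_of_mul_eq ((partialHom F).D_wy_semiconj_U_left a).eq.symm
      change (partialHom F).Y a ∈ H
      rw [h]
      exact mul_mem (mul_mem (hD _ _) (hU _ _ _)) (inv_mem (hD _ _))
    rw [toCompletion_mul_one _ _ (mul_mem (blk_mem_one _) (xb_mem _)) (mm_mem_one _ _ _),
      toCompletion_mul_one _ _ (blk_mem_one _) (xb_mem _)]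
    exact mul_mem (mul_mem (hD _ _) hx) (hU _ _ _)
  have hS : ∀ g ∈ slim F .S12, inc .S12 g ∈ H := by
    intro g hg
    change g ∈ S12 F at hg
    rw [S12_eq_range] at hg
    obtain ⟨⟨a, b⟩, rfl⟩ := hg
    have := hD a b
    change toCompletion (blk a b) ∈ H at this
    rwa [toCompletion_blk] at this
  have hQ1 : ∀ g ∈ slim F .Q11, inc .Q11 g ∈ H := by
    intro g hg
    rw [← toCompletion_Q11 hg]
    exact h1 g (Q11_eq_fixer (F := F) ▸ hg)
  have hQ2 : ∀ g ∈ slim F .Q12, inc .Q12 g ∈ H := by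
    intro g hg
    rw [← toCompletion_Q12 hg]
    exact h0 g (Q12_eq_fixer (F := F) ▸ hg)
  apply Amalgam.eq_top_of_ι_mem
  rintro β ⟨g, hg⟩
  change g ∈ slim F β at hg
  have key : inc β g ∈ H := by
    cases β with
    | S1 =>
      rw [← inc_of_lt (γ := .S12) (by decide) hg]
      exact hS _ (Subgroup.subset_closure (Or.inl hg))
    | S2 =>
      rw [← inc_of_lt (γ := .S12) (by decide) hg]
      exact hS _ (Subgroup.subset_closure (Or.inr hg))
    | M1 =>
      rw [← inc_of_lt (γ := .Q11) (by decide) hg]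
      exact hQ1 _ (Subgroup.subset_closure (Or.inl hg))
    | S12 => exact hS _ hg
    | Q11 => exact hQ1 _ hg
    | Q12 => exact hQ2 _ hg
  rwa [inc_eq hg] at key

variable (F) in
theorem isUniversalCompletion_slim :
    Amalgam.IsUniversalCompletion (slim F) (slim_monotone F) := by
  let π := (amalgam F).lift (fun β => (slim F β).subtype) (fun _ _ => rfl)
  have hι : ∀ β, ∀ g ∈ slim F β, π (inc β g) = g := fun β g hg => by
    rw [inc_eq hg]
    exact (amalgam F).lift_ι _ _ β ⟨g, hg⟩
  have hD : ∀ a b, π (toCompletion (blk a b)) = blk a b := fun a b => by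
    rw [toCompletion_blk, hι _ _ (blk_mem_S12 a b)]
  have h1 : ∀ g ∈ fixer (e F 1), π (toCompletion g) = g := fun g hg => by
    rw [← Q11_eq_fixer] at hg
    rw [toCompletion_Q11 hg, hι .Q11 g hg]
  have h0 : ∀ g ∈ fixer (e F 0), π (toCompletion g) = g := fun g hg => by
    rw [← Q12_eq_fixer] at hg
    rw [toCompletion_Q12 hg, hι .Q12 g hg]
  refine ⟨(partialHom F).injective_of_leftInverse (fun H => eq_top_of_mem) π hD h1 h0, ?_⟩
  rw [← MonoidHom.range_eq_top]
  exact eq_top_of_blk_mem (fun a b => ⟨_, hD a b⟩) (fun g hg => ⟨_, h0 g hg⟩)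
    (fun g hg => ⟨_, h1 g hg⟩)

end Symp

theorem corollary1p2 (F : Type u) [Field F] (hF : 2 < ENat.card F) :
    Amalgam.IsUniversalCompletion (Symp.slim F) (Symp.slim_monotone F) ∧
    Nonempty (Symp.S12 F ≃* Symp.Sp F 1 × Symp.Sp F 1) ∧
    Nonempty (Symp.Q11 F ≃* Symp.Q12 F) ∧
    Nonempty (Symp.Q11 F ≃* Symp.Heis F ⋊[Symp.Heis.act] Symp.Sp F 1) ∧
    (ringChar F = 2 → Nonempty (Symp.Heis F ≃* Multiplicative (Fin 3 → F))) :=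
  ⟨Symp.isUniversalCompletion_slim F, Symp.nonempty_S12_equiv F, Symp.nonempty_Q11_equiv_Q12 F,
    Symp.nonempty_Q11_equiv_semidirect F, Symp.nonempty_heis_equiv⟩
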